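/- **Theorem.** Let $n\ge 0$ and $\hbar>0$. Let $\mathcal{H}L^2(\mathbb{C}^n,e^{-p^2/\hbar}\,dq\,dp)$ be the space of holomorphic functions $F$ on $\mathbb{C}^n$ with $\int_{\mathbb{R}^n}\int_{\mathbb{R}^n}|F(q+ip)|^2e^{-p^2/\hbar}\,dq\,dp<\infty$, with the inner product $\langle F,G\rangle=\int\int\overline{F(q+ip)}\,G(q+ip)\,e^{-p^2/\hbar}\,dq\,dp$. For $F\in\mathcal{H}L^2(\mathbb{C}^n,e^{-p^2/\hbar}\,dq\,dp)$ and $f\in L^2(\mathbb{R}^n)$ consider the pairing $$\langle F,f\rangle_{pair}=\int_{\mathbb{R}^n}\int_{\mathbb{R}^n}\overline{F(q+ip)}\,f(q)\,e^{-p^2/2\hbar}\,dq\,dp .$$ This integral is absolutely convergent for all $F$, $f$ in suitable dense subspaces of the two spaces. There is a unique bounded linear operator $\Pi_\hbar:L^2(\mathbb{R}^n)\to\mathcal{H}L^2(\mathbb{C}^n,e^{-p^2/\hbar}\,dq\,dp)$ such that $$\langle F,f\rangle_{pair}=\langle F,\Pi_\hbar f\rangle$$ whenever the integral defining $\langle F,f\rangle_{pair}$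 is absolutely convergent. For all $F$ and $f$ the integral over $\{|p|\le R\}$ is absolutely convergent and tends to $\langle F,\Pi_\hbar f\rangle=\langle\Pi_\hbar^*F,f\rangle_{L^2(\mathbb{R}^n)}$ as $R\to\infty$, where $\Pi_\hbar^*:\mathcal{H}L^2(\mathbb{C}^n,e^{-p^2/\hbar}\,dq\,dp)\to L^2(\mathbb{R}^n)$ is the (bounded) adjoint of $\Pi_\hbar$. Moreover: 1. For all $f\in L^2(\mathbb{R}^n)$ and $z\in\mathbb{C}^n$, $$\Pi_\hbar f(z)=a_\hbar\int_{\mathbb{R}^n}e^{-(z-q)^2/2\hbar}f(q)\,dq,\qquad a_\hbar=(\pi\hbar)^{-n/2},$$ where the integral is absolutely convergent and $(z-q)^2=\sum_k(z_k-q_k)^2$. 2. For all $F\in\mathcal{H}L^2(\mathbb{C}^n,e^{-p^2/\hbar}\,dq\,dp)$, $$(\Pi_\hbar^*F)(q)=\int_{\mathbb{R}^n}F(q+ip)\,e^{-p^2/2\hbar}\,dp ,$$ in the sense that the integrals over $\{|p|\le R\}$ are square-integrable functions of $q$ that converge to $\Pi_\hbar^*F$ in $L^2(\mathbb{R}^n)$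 as $R\to\infty$; and the formula holds literally for almost every $q$ at which the integral over $\mathbb{R}^n$ is absolutely convergent. 3. The map $b_\hbar\Pi_\hbar$ is unitary from $L^2(\mathbb{R}^n)$ onto $\mathcal{H}L^2(\mathbb{C}^n,e^{-p^2/\hbar}\,dq\,dp)$, where $b_\hbar=(\pi\hbar)^{n/4}(2\pi\hbar)^{-n/2}=(4\pi\hbar)^{-n/4}$. -/

import Mathlib

open MeasureTheory Filter Topology
open scoped ComplexConjugate InnerProductSpace

/-- Real `n`-space with its Euclidean norm and Lebesgue measure. -/
abbrev RSpace (n : ℕ) : Type := EuclideanSpace ℝ (Fin n)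

/-- Complex `n`-space. -/
abbrev CSpace (n : ℕ) : Type := Fin n → ℂ

/-- The identification of the phase space with `ℂⁿ`: the point `(q, p)` goes to `q + i p`. -/
noncomputable def phasePoint {n : ℕ} (x : RSpace n × RSpace n) : CSpace n :=
  fun k => (x.1 k : ℂ) + Complex.I * (x.2 k : ℂ)

/-- The measure `exp (-p² / ħ) dq dp` on `ℂⁿ`, where `z = q + i p`. -/
noncomputable def kaehlerMeasure (n : ℕ) (ħ : ℝ) : Measure (CSpace n) :=
  ((volume : Measure (RSpace n × RSpace n)).withDensity
    (fun x => ENNReal.ofReal (Real.exp (-‖x.2‖ ^ 2 / ħ)))).map phasePoint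

theorem continuous_phasePoint {n : ℕ} : Continuous (phasePoint (n := n)) := by
  unfold phasePoint
  fun_prop

theorem surjective_phasePoint {n : ℕ} : Function.Surjective (phasePoint (n := n)) := by
  intro z
  refine ⟨(WithLp.toLp 2 fun k => (z k).re, WithLp.toLp 2 fun k => (z k).im), ?_⟩
  funext k
  simp only [phasePoint]
  rw [mul_comm]
  exact Complex.re_add_im (z k)

instance kaehlerMeasure_isOpenPos (n : ℕ) (ħ : ℝ) :
    (kaehlerMeasure n ħ).IsOpenPosMeasure := by
  have hac : (volume : Measure (RSpace n × RSpace n)) ≪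
      (volume : Measure (RSpace n × RSpace n)).withDensity
        (fun x => ENNReal.ofReal (Real.exp (-‖x.2‖ ^ 2 / ħ))) := by
    refine withDensity_absolutelyContinuous' ?_ ?_
    · fun_prop
    · refine Eventually.of_forall fun x => ?_
      simp [Real.exp_pos]
  have : ((volume : Measure (RSpace n × RSpace n)).withDensity
        (fun x => ENNReal.ofReal (Real.exp (-‖x.2‖ ^ 2 / ħ)))).IsOpenPosMeasure :=
    hac.isOpenPosMeasure
  exact continuous_phasePoint.isOpenPosMeasure_map surjective_phasePoint

/-- The vector space of holomorphic functions on `ℂⁿ` that are square-integrable with respect to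
`exp (-p² / ħ) dq dp`. -/
def holL2Submodule (n : ℕ) (ħ : ℝ) : Submodule ℂ (CSpace n → ℂ) where
  carrier := {F | Differentiable ℂ F ∧ MemLp F 2 (kaehlerMeasure n ħ)}
  add_mem' := fun hF hG => ⟨hF.1.add hG.1, hF.2.add hG.2⟩
  zero_mem' := ⟨differentiable_const 0, MemLp.zero⟩
  smul_mem' := fun c _ hF => ⟨hF.1.const_smul c, hF.2.const_smul c⟩

/-- The Segal-Bargmann space `HL²(ℂⁿ, exp (-p² / ħ) dq dp)`; its elements are holomorphic functions
(not classes of functions). -/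
def HolL2 (n : ℕ) (ħ : ℝ) : Type := holL2Submodule n ħ

namespace HolL2

variable {n : ℕ} {ħ : ℝ}

instance : AddCommGroup (HolL2 n ħ) := inferInstanceAs (AddCommGroup (holL2Submodule n ħ))

instance : Module ℂ (HolL2 n ħ) := inferInstanceAs (Module ℂ (holL2Submodule n ħ))

/-- The holomorphic function that an element of the Segal-Bargmann space is. -/
def toFun (F : HolL2 n ħ) : CSpace n → ℂ := Subtype.val (p := (· ∈ holL2Submodule n ħ)) F

instance : CoeFun (HolL2 n ħ) (fun _ => CSpace n → ℂ) := ⟨toFun⟩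

theorem ext_fun {F G : HolL2 n ħ} (h : ∀ z, F z = G z) : F = G :=
  Subtype.ext (p := (· ∈ holL2Submodule n ħ)) (funext h)

theorem differentiable (F : HolL2 n ħ) : Differentiable ℂ (F : CSpace n → ℂ) :=
  (Subtype.property (p := (· ∈ holL2Submodule n ħ)) F).1

theorem memLp (F : HolL2 n ħ) : MemLp (F : CSpace n → ℂ) 2 (kaehlerMeasure n ħ) :=
  (Subtype.property (p := (· ∈ holL2Submodule n ħ)) F).2

theorem add_apply (F G : HolL2 n ħ) (z : CSpace n) : (F + G) z = F z + G z := rfl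

theorem smul_apply (c : ℂ) (F : HolL2 n ħ) (z : CSpace n) : (c • F) z = c * F z := rfl

theorem zero_apply (z : CSpace n) : (0 : HolL2 n ħ) z = 0 := rfl

theorem integrable_conj_mul (F G : HolL2 n ħ) :
    Integrable (fun z => conj (F z) * G z) (kaehlerMeasure n ħ) := by
  have hF : MemLp (fun z => conj (F z)) 2 (kaehlerMeasure n ħ) := F.memLp.star
  exact hF.integrable_mul G.memLp

/-- The inner product `⟪F, G⟫ = ∫ conj F * G * exp (-p² / ħ) dq dp`. -/
@[reducible]
noncomputable def innerCore (n : ℕ) (ħ : ℝ) : InnerProductSpace.Core ℂ (HolL2 n ħ) where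
  inner F G := ∫ z, conj (F z) * G z ∂(kaehlerMeasure n ħ)
  conj_inner_symm F G := by
    rw [← integral_conj]
    refine integral_congr_ae (Eventually.of_forall fun z => ?_)
    simp [mul_comm]
  re_inner_nonneg F := by
    have h : (fun z => conj (F z) * F z) = fun z => ((‖F z‖ ^ 2 : ℝ) : ℂ) := by
      funext z
      rw [RCLike.conj_mul]
      norm_cast
    rw [h, integral_complex_ofReal]
    exact_mod_cast integral_nonneg fun z => by positivity
  add_left F G H := by
    rw [← integral_add (integrable_conj_mul F H) (integrable_conj_mul G H)]
    refine integral_congr_ae (Eventually.of_forall fun z => ?_)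
    simp [add_apply, add_mul]
  smul_left F G c := by
    rw [← integral_const_mul]
    refine integral_congr_ae (Eventually.of_forall fun z => ?_)
    simp [smul_apply, mul_assoc]
  definite F hF := by
    have h : (fun z => conj (F z) * F z) = fun z => ((‖F z‖ ^ 2 : ℝ) : ℂ) := by
      funext z
      rw [RCLike.conj_mul]
      norm_cast
    have hi : Integrable (fun z => ‖F z‖ ^ 2) (kaehlerMeasure n ħ) := by
      simpa using F.memLp.integrable_norm_pow (by norm_num)
    have h0 : ∫ z, ‖F z‖ ^ 2 ∂(kaehlerMeasure n ħ) = 0 := by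
      rw [h, integral_complex_ofReal] at hF
      exact_mod_cast hF
    rw [integral_eq_zero_iff_of_nonneg (fun z => by positivity) hi] at h0
    have hc : Continuous (F : CSpace n → ℂ) := F.differentiable.continuous
    have h1 := Continuous.ae_eq_iff_eq (kaehlerMeasure n ħ)
      (f := fun z => ‖F z‖ ^ 2) (g := 0) (by fun_prop) continuous_zero |>.1 h0
    refine ext_fun fun z => ?_
    have h2 := congrFun h1 z
    rw [zero_apply]
    simpa using h2

noncomputable instance : NormedAddCommGroup (HolL2 n ħ) :=
  (innerCore n ħ).toNormedAddCommGroup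

noncomputable instance : InnerProductSpace ℂ (HolL2 n ħ) :=
  InnerProductSpace.ofCore (innerCore n ħ).toCore

theorem inner_def (F G : HolL2 n ħ) :
    ⟪F, G⟫_ℂ = ∫ z, conj (F z) * G z ∂(kaehlerMeasure n ħ) := rfl

end HolL2

/-- The Hilbert space `L²(ℝⁿ)` of complex-valued functions. -/
abbrev L2R (n : ℕ) : Type := Lp ℂ 2 (volume : Measure (RSpace n))

/-- The integrand `conj (F (q + i p)) * f q * exp (-p² / 2ħ)` of the pairing of `F` with `f`,
as a function of `(q, p)`. -/
noncomputable def pairingIntegrand {n : ℕ} {ħ : ℝ} (F : HolL2 n ħ) (f : L2R n)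
    (x : RSpace n × RSpace n) : ℂ :=
  conj (F (phasePoint x)) * f x.1 * (Real.exp (-‖x.2‖ ^ 2 / (2 * ħ)) : ℂ)

/-- `T` represents the pairing: `⟪F, T f⟫` is the pairing integral of `F` with `f`
whenever that integral is absolutely convergent. -/
def RepresentsPairing {n : ℕ} {ħ : ℝ} (T : L2R n →L[ℂ] HolL2 n ħ) : Prop :=
  ∀ (F : HolL2 n ħ) (f : L2R n), Integrable (pairingIntegrand F f) →
    ∫ x, pairingIntegrand F f x = ⟪F, T f⟫_ℂ

/-- The pairing integral of `F` with `f` converges to `c` in the following sense: it is absolutely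
convergent over every region `‖p‖ ≤ R`, and these integrals tend to `c` as `R → ∞`. -/
def HasPairing {n : ℕ} {ħ : ℝ} (F : HolL2 n ħ) (f : L2R n) (c : ℂ) : Prop :=
  (∀ R : ℝ, IntegrableOn (pairingIntegrand F f) (Set.univ ×ˢ Metric.closedBall 0 R)) ∧
  Tendsto (fun R : ℝ => ∫ x in Set.univ ×ˢ Metric.closedBall 0 R, pairingIntegrand F f x)
    atTop (𝓝 c)

/-- The function `p ↦ F (q + i p) * exp (-p² / 2ħ)` on the fiber over `q`. -/
noncomputable def fiberIntegrand {n : ℕ} {ħ : ℝ} (F : HolL2 n ħ) (q p : RSpace n) : ℂ :=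
  F (phasePoint (q, p)) * (Real.exp (-‖p‖ ^ 2 / (2 * ħ)) : ℂ)

/-- The Gaussian kernel `exp (-(z - q)² / 2ħ)`, where `w² = w₁² + ⋯ + wₙ²` (no conjugates). -/
noncomputable def gaussKernel {n : ℕ} (ħ : ℝ) (z : CSpace n) (q : RSpace n) : ℂ :=
  Complex.exp (-(∑ k, (z k - (q k : ℂ)) ^ 2) / (2 * (ħ : ℂ)))

/-! Let `T` be the Gaussian transform with kernel `a_ħ exp (-(z - q)² / 2ħ)`. On the horizontal
slice at height `p`, the Fourier transform in `q` of `Tf(q + ip) exp (-p² / 2ħ)` is `2^(n/2) exp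
(-|p + 2πħξ|² / 2ħ)` times that of `f` (`weighted_gaussTransform_eq`). Everything analytic follows
from this identity.

Isometry: by Plancherel in `q` and Tonelli in `p`, the squared norm of `Tf` involves only the
integral of the squared Gaussian over `p`, which does not depend on `ξ`. Hence `‖Tf‖ = (4πħ)^(n/4)
‖f‖`.

Surjectivity: `T` sends the Gaussian centred at `v ∈ ℂⁿ` to `coherent ħ v`. The inner product of `F`
with the coherent state centred at the conjugate of `w` is a nonzero constant times `F w`: after
translation by `w` the integrand is a holomorphic function times a rotation-invariant Gaussian, and
the mean value property applies. So nothing nonzero is orthogonal to the range, and `T` is a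
multiple of a unitary `U`.

Pairing: the fiber integral of `Tf` over `‖p‖ ≤ R` is a Fourier multiplier applied to `f`. The
multipliers are uniformly bounded and tend to `(4πħ)^(n/2)`, the scalar by which `T*T` acts, so
these integrals tend to `T*Tf` in `L²`. Since `T` is onto, this covers every `F`, and Fubini turns
it into convergence of the truncated pairing to `⟪T*F, f⟫ = ⟪F, Tf⟫`. Uniqueness holds because the
coherent states span a dense subspace and pair absolutely with every `f`. -/

open scoped FourierTransform ContDiff

/-! ### The `L²` Fourier transform as an integral -/

section FourierL2

variable {E : Type*} [NormedAddCommGroup E] [InnerProductSpace ℝ E]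
    [FiniteDimensional ℝ E] [MeasurableSpace E] [BorelSpace E]

theorem integral_mul_fourier_eq {g h : E → ℂ} (hg : Integrable g) (hh : Integrable h) :
    ∫ x, 𝓕 g x * h x = ∫ x, g x * 𝓕 h x := by
  have := VectorFourier.integral_fourierIntegral_smul_eq_flip (L := innerₗ E) (μ := volume)
    (ν := volume) Real.continuous_fourierChar continuous_inner hg hh
  rw [flip_innerₗ] at this
  exact this

theorem integral_mul_fourierInv_eq {g h : E → ℂ} (hg : Integrable g) (hh : Integrable h) :
    ∫ x, 𝓕⁻ g x * h x = ∫ x, g x * 𝓕⁻ h x := by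
  have h1 : ∀ f : E → ℂ, 𝓕⁻ f = fun x => 𝓕 (fun y => f (-y)) x := fun f =>
    funext fun x => by rw [Real.fourierInv_eq_fourier_comp_neg]
  rw [h1 g, h1 h, integral_mul_fourier_eq hg.comp_neg hh,
    ← integral_neg_eq_self (fun x => g (-x) * 𝓕 h x)]
  simp [← Real.fourierInv_eq_fourier_neg, Real.fourierInv_eq_fourier_comp_neg]

theorem continuous_fourier_of_integrable {h : E → ℂ} (h1 : Integrable h) : Continuous (𝓕 h) :=
  VectorFourier.fourierIntegral_continuous Real.continuous_fourierChar
      (by exact continuous_inner) h1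

theorem continuous_fourierInv_of_integrable {h : E → ℂ} (h1 : Integrable h) :
    Continuous (𝓕⁻ h) := by
  have : 𝓕⁻ h = fun x => 𝓕 h (-x) := funext fun x => Real.fourierInv_eq_fourier_neg h x
  rw [this]
  exact (continuous_fourier_of_integrable h1).comp continuous_neg

/-- The Fourier transform of `L²` agrees with the Fourier integral on `L¹ ∩ L²`. -/
theorem fourier_toLp_ae_eq {h : E → ℂ} (h1 : Integrable h) (h2 : MemLp h 2) :
    ((𝓕 (h2.toLp h) : Lp ℂ 2 (volume : Measure E)) : E → ℂ) =ᵐ[volume] 𝓕 h := by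
  -- Both sides are tested against smooth compactly supported functions; the `L²` transform is the
  -- distributional one, so the transform moves onto the test function and back.
  refine ae_eq_of_integral_contDiff_smul_eq
    ((Lp.memLp _).locallyIntegrable (by norm_num))
    (continuous_fourier_of_integrable h1).locallyIntegrable fun g hg hgc => ?_
  have hc : HasCompactSupport (fun x => (g x : ℂ)) := hgc.comp_left (g := ((↑) : ℝ → ℂ)) (by simp)
  have hs : ContDiff ℝ ∞ (fun x => (g x : ℂ)) := Complex.ofRealCLM.contDiff.comp hg
  let φ : SchwartzMap E ℂ := hc.toSchwartzMap hs
  have key := congrArg (fun T => T φ) (Lp.fourier_toTemperedDistribution_eq (h2.toLp h))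
  simp only [TemperedDistribution.fourier_apply, Lp.toTemperedDistribution_apply] at key
  calc _ = ∫ x, φ x • (𝓕 (h2.toLp h) : Lp ℂ 2 (volume : Measure E)) x := by
        simp [φ]
    _ = ∫ x, (𝓕 φ) x • (h2.toLp h) x := key.symm
    _ = ∫ x, 𝓕 (φ : E → ℂ) x * h x := by
        refine integral_congr_ae ?_
        filter_upwards [h2.coeFn_toLp] with x hx
        rw [hx, SchwartzMap.fourier_coe, smul_eq_mul]
    _ = ∫ x, φ x * 𝓕 h x := integral_mul_fourier_eq φ.integrable h1
    _ = _ := by simp [φ]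

/-- The inverse Fourier transform of `L²` agrees with the inverse Fourier integral
on `L¹ ∩ L²`. -/
theorem fourierInv_toLp_ae_eq {h : E → ℂ} (h1 : Integrable h) (h2 : MemLp h 2) :
    ((𝓕⁻ (h2.toLp h) : Lp ℂ 2 (volume : Measure E)) : E → ℂ) =ᵐ[volume] 𝓕⁻ h := by
  refine ae_eq_of_integral_contDiff_smul_eq
    ((Lp.memLp _).locallyIntegrable (by norm_num))
    (continuous_fourierInv_of_integrable h1).locallyIntegrable fun g hg hgc => ?_
  have hc : HasCompactSupport (fun x => (g x : ℂ)) := hgc.comp_left (g := ((↑) : ℝ → ℂ)) (by simp)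
  have hs : ContDiff ℝ ∞ (fun x => (g x : ℂ)) := Complex.ofRealCLM.contDiff.comp hg
  let φ : SchwartzMap E ℂ := hc.toSchwartzMap hs
  have key := congrArg (fun T => T φ) (Lp.fourierInv_toTemperedDistribution_eq (h2.toLp h))
  simp only [TemperedDistribution.fourierInv_apply, Lp.toTemperedDistribution_apply] at key
  calc _ = ∫ x, φ x • (𝓕⁻ (h2.toLp h) : Lp ℂ 2 (volume : Measure E)) x := by
        simp [φ]
    _ = ∫ x, (𝓕⁻ φ) x • (h2.toLp h) x := key.symm
    _ = ∫ x, 𝓕⁻ (φ : E → ℂ) x * h x := by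
        refine integral_congr_ae ?_
        filter_upwards [h2.coeFn_toLp] with x hx
        rw [hx, SchwartzMap.fourierInv_coe, smul_eq_mul]
    _ = ∫ x, φ x * 𝓕⁻ h x := integral_mul_fourierInv_eq φ.integrable h1
    _ = _ := by simp [φ]

/-- Plancherel for the actual integral rather than its `L²` class, as needed for slices that are
given pointwise. -/
theorem eLpNorm_fourierInv_eq {h : E → ℂ} (h1 : Integrable h) (h2 : MemLp h 2) :
    eLpNorm (𝓕⁻ h) 2 volume = eLpNorm h 2 volume := by
  rw [← eLpNorm_congr_ae (fourierInv_toLp_ae_eq h1 h2), ← eLpNorm_congr_ae h2.coeFn_toLp,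
    ← Lp.enorm_def, ← Lp.enorm_def, enorm_eq_iff_norm_eq]
  exact (Lp.fourierTransformₗᵢ E ℂ).symm.norm_map _

end FourierL2

/-! ### Gaussian integrals with complex centre -/

section Gaussian

variable {n : ℕ}

theorem ofReal_norm_sq_eq_sum (q : RSpace n) : ((‖q‖ ^ 2 : ℝ) : ℂ) = ∑ k, (q k : ℂ) ^ 2 := by
  rw [EuclideanSpace.norm_sq_eq]
  push_cast
  simp [← Complex.ofReal_pow]

theorem integrable_cexp_quadratic_rspace {b : ℂ} (hb : 0 < b.re) (w : CSpace n) :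
    Integrable (fun q : RSpace n => Complex.exp (-b * ∑ k, (q k : ℂ) ^ 2 + ∑ k, w k * q k)) := by
  rw [← (PiLp.volume_preserving_toLp (Fin n)).integrable_comp_emb
    (MeasurableEquiv.toLp 2 _).measurableEmbedding]
  exact GaussianFourier.integrable_cexp_neg_mul_sum_add hb w

theorem integral_cexp_quadratic_rspace {b : ℂ} (hb : 0 < b.re) (w : CSpace n) :
    ∫ q : RSpace n, Complex.exp (-b * ∑ k, (q k : ℂ) ^ 2 + ∑ k, w k * q k) =
      (Real.pi / b) ^ (n / 2 : ℂ) * Complex.exp ((∑ k, w k ^ 2) / (4 * b)) := by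
  rw [← (PiLp.volume_preserving_toLp (Fin n)).integral_comp
    (MeasurableEquiv.toLp 2 _).measurableEmbedding]
  simpa using! GaussianFourier.integral_cexp_neg_mul_sum_add hb w

theorem continuous_gaussKernel (ħ : ℝ) :
    Continuous (fun x : CSpace n × RSpace n => gaussKernel ħ x.1 x.2) := by
  unfold gaussKernel
  fun_prop

theorem gaussKernel_eq (ħ : ℝ) (z : CSpace n) (q : RSpace n) :
    gaussKernel ħ z q = Complex.exp (-(∑ k, z k ^ 2) / (2 * ħ)) *
      Complex.exp (-(1 / (2 * ħ) : ℂ) * ∑ k, (q k : ℂ) ^ 2 + ∑ k, (z k / ħ) * q k) := by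
  rw [gaussKernel, ← Complex.exp_add]
  congr 1
  simp only [Finset.mul_sum, ← Finset.sum_neg_distrib, Finset.sum_div, ← Finset.sum_add_distrib]
  refine Finset.sum_congr rfl fun k _ => ?_
  -- At `ħ = 0` all quotients are zero by the convention on division.
  by_cases h : (ħ : ℂ) = 0
  · simp [h]
  · field_simp
    ring

theorem re_one_div_two_mul_pos {ħ : ℝ} (hħ : 0 < ħ) : 0 < (1 / (2 * ħ) : ℂ).re := by
  have : (1 / (2 * ħ) : ℂ) = ((1 / (2 * ħ) : ℝ) : ℂ) := by push_cast; rfl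
  rw [this, Complex.ofReal_re]
  positivity

theorem integrable_gaussKernel {ħ : ℝ} (hħ : 0 < ħ) (z : CSpace n) :
    Integrable (gaussKernel ħ z) := by
  simp_rw [funext (gaussKernel_eq ħ z)]
  exact (integrable_cexp_quadratic_rspace (re_one_div_two_mul_pos hħ) _).const_mul _

/-- Squaring only halves `ħ`, which reduces square-integrability of the kernel to integrability. -/
theorem gaussKernel_sq (ħ : ℝ) (z : CSpace n) (q : RSpace n) :
    gaussKernel ħ z q ^ 2 = gaussKernel (ħ / 2) z q := by
  rw [gaussKernel, gaussKernel, ← Complex.exp_nat_mul]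
  congr 1
  push_cast
  by_cases h : (ħ : ℂ) = 0
  · simp [h]
  · field_simp

theorem memLp_gaussKernel {ħ : ℝ} (hħ : 0 < ħ) (z : CSpace n) :
    MemLp (gaussKernel ħ z) 2 := by
  rw [memLp_two_iff_integrable_sq_norm]
  · simp_rw [← norm_pow, gaussKernel_sq]
    exact (integrable_gaussKernel (half_pos hħ) z).norm
  · exact ((continuous_gaussKernel ħ).comp
      (by fun_prop : Continuous fun q => (z, q))).aestronglyMeasurable

/-- The complex centre and the character only add a linear term to the exponent. Completing the
square produces `z² / 2ħ`, which cancels the prefactor from `gaussKernel_eq`. -/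
theorem fourier_gaussKernel {ħ : ℝ} (hħ : 0 < ħ) (z : CSpace n) (ξ : RSpace n) :
    𝓕 (gaussKernel ħ z) ξ = (((2 * Real.pi * ħ) ^ ((n : ℝ) / 2) : ℝ) : ℂ) *
      Complex.exp (-(2 * Real.pi * Complex.I) * ∑ k, z k * ξ k
        - 2 * Real.pi ^ 2 * ħ * ∑ k, (ξ k : ℂ) ^ 2) := by
  rw [Real.fourier_eq']
  have hc : (ħ : ℂ) ≠ 0 := by exact_mod_cast hħ.ne'
  have h1 : ∀ q : RSpace n, Complex.exp (((-2 * Real.pi * ⟪q, ξ⟫_ℝ : ℝ) : ℂ) * Complex.I) •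
      gaussKernel ħ z q = Complex.exp (-(∑ k, z k ^ 2) / (2 * ħ)) *
      Complex.exp (-(1 / (2 * ħ) : ℂ) * ∑ k, (q k : ℂ) ^ 2 +
        ∑ k, (z k / ħ - 2 * Real.pi * Complex.I * ξ k) * q k) := fun q => by
    rw [gaussKernel_eq, smul_eq_mul, mul_left_comm, ← Complex.exp_add]
    congr 2
    simp only [PiLp.inner_apply, RCLike.inner_apply, conj_trivial, sub_mul, Finset.sum_sub_distrib]
    have : ∑ k, 2 * Real.pi * Complex.I * ξ k * q k =
        (2 * Real.pi * Complex.I) * ∑ k, (ξ k : ℂ) * q k := by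
      rw [Finset.mul_sum]
      exact Finset.sum_congr rfl fun k _ => by ring
    rw [this]
    push_cast
    ring
  simp_rw [h1]
  rw [integral_const_mul, integral_cexp_quadratic_rspace (re_one_div_two_mul_pos hħ),
    mul_left_comm, ← Complex.exp_add]
  congr 1
  · rw [Complex.ofReal_cpow (by positivity)]
    push_cast
    congr 1
    field_simp
  · congr 1
    have h2 : ∑ k, (z k / ħ - 2 * Real.pi * Complex.I * ξ k) ^ 2 = (∑ k, z k ^ 2) / ħ ^ 2 -
        4 * Real.pi * Complex.I / ħ * ∑ k, z k * ξ k - 4 * Real.pi ^ 2 * ∑ k, (ξ k : ℂ) ^ 2 := by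
      rw [Finset.sum_div, Finset.mul_sum, Finset.mul_sum, ← Finset.sum_sub_distrib,
        ← Finset.sum_sub_distrib]
      refine Finset.sum_congr rfl fun k _ => ?_
      field_simp
      linear_combination (4 * Real.pi ^ 2 * ħ ^ 2 * (ξ k : ℂ) ^ 2) * Complex.I_sq
    rw [h2]
    field_simp
    ring

end Gaussian

/-! ### The weighted measure in phase-space coordinates -/

section KaehlerMeasure

variable {n : ℕ} {ħ : ℝ}

theorem lintegral_kaehlerMeasure {g : CSpace n → ENNReal} (hg : Measurable g) :
    ∫⁻ z, g z ∂(kaehlerMeasure n ħ) = ∫⁻ x : RSpace n × RSpace n,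
      ENNReal.ofReal (Real.exp (-‖x.2‖ ^ 2 / ħ)) * g (phasePoint x) := by
  rw [kaehlerMeasure, lintegral_map hg continuous_phasePoint.measurable,
    lintegral_withDensity_eq_lintegral_mul _ (by fun_prop)
      (show Measurable fun x => g (phasePoint x) from
        hg.comp continuous_phasePoint.measurable)]
  rfl

theorem exp_half_sq (ħ : ℝ) (p : RSpace n) :
    Real.exp (-‖p‖ ^ 2 / (2 * ħ)) ^ 2 = Real.exp (-‖p‖ ^ 2 / ħ) := by
  rw [← Real.exp_nat_mul]
  congr 1
  by_cases h : ħ = 0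
  · simp [h]
  · push_cast
    field_simp

/-- The function `(q, p) ↦ F (q + i p) exp (-p² / 2ħ)` on the phase space. -/
noncomputable def weighted (ħ : ℝ) (F : CSpace n → ℂ) (x : RSpace n × RSpace n) : ℂ :=
  F (phasePoint x) * (Real.exp (-‖x.2‖ ^ 2 / (2 * ħ)) : ℂ)

theorem continuous_weighted {F : CSpace n → ℂ} (hF : Continuous F) :
    Continuous (weighted ħ F) := by
  have : Continuous fun x : RSpace n × RSpace n => F (phasePoint x) :=
    hF.comp continuous_phasePoint
  exact this.mul (by fun_prop)

theorem lintegral_enorm_sq_kaehlerMeasure {F : CSpace n → ℂ} (hF : Continuous F) :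
    ∫⁻ z, ‖F z‖ₑ ^ 2 ∂(kaehlerMeasure n ħ) = ∫⁻ x, ‖weighted ħ F x‖ₑ ^ 2 := by
  rw [lintegral_kaehlerMeasure (by fun_prop)]
  refine lintegral_congr fun x => ?_
  have : ‖((Real.exp (-‖x.2‖ ^ 2 / (2 * ħ)) : ℝ) : ℂ)‖ₑ ^ 2 =
      ENNReal.ofReal (Real.exp (-‖x.2‖ ^ 2 / ħ)) := by
    rw [← exp_half_sq ħ, ENNReal.ofReal_pow (Real.exp_pos _).le, ← ofReal_norm,
      Complex.norm_real, Real.norm_of_nonneg (Real.exp_pos _).le]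
  rw [weighted, enorm_mul, mul_pow, this, mul_comm]

theorem memLp_two_iff_lintegral {α : Type*} [MeasurableSpace α] {μ : Measure α} {f : α → ℂ}
    (hf : AEStronglyMeasurable f μ) : MemLp f 2 μ ↔ ∫⁻ x, ‖f x‖ₑ ^ 2 ∂μ < ⊤ := by
  rw [MemLp, and_iff_right hf,
    eLpNorm_lt_top_iff_lintegral_rpow_enorm_lt_top (by norm_num) (by norm_num)]
  simp

theorem eLpNorm_two_sq {α : Type*} [MeasurableSpace α] {μ : Measure α} (f : α → ℂ) :
    eLpNorm f 2 μ ^ 2 = ∫⁻ x, ‖f x‖ₑ ^ 2 ∂μ := by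
  rw [eLpNorm_eq_lintegral_rpow_enorm_toReal (by norm_num) (by norm_num), ← ENNReal.rpow_natCast,
    ← ENNReal.rpow_mul]
  simp

theorem memLp_kaehlerMeasure_iff {F : CSpace n → ℂ} (hF : Continuous F) :
    MemLp F 2 (kaehlerMeasure n ħ) ↔ MemLp (weighted ħ F) 2 volume := by
  rw [memLp_two_iff_lintegral hF.aestronglyMeasurable,
    memLp_two_iff_lintegral (continuous_weighted hF).aestronglyMeasurable,
    lintegral_enorm_sq_kaehlerMeasure hF]

theorem integral_kaehlerMeasure {g : CSpace n → ℂ} (hg : Continuous g) :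
    ∫ z, g z ∂(kaehlerMeasure n ħ) = ∫ x : RSpace n × RSpace n,
      (Real.exp (-‖x.2‖ ^ 2 / ħ) : ℂ) * g (phasePoint x) := by
  rw [kaehlerMeasure, integral_map continuous_phasePoint.aemeasurable hg.aestronglyMeasurable,
    integral_withDensity_eq_integral_toReal_smul (by fun_prop) (by simp)]
  refine integral_congr_ae (Eventually.of_forall fun x => ?_)
  simp only
  rw [ENNReal.toReal_ofReal (Real.exp_pos _).le, Complex.real_smul]

theorem integrable_kaehlerMeasure {g : CSpace n → ℂ} (hg : Continuous g) :
    Integrable g (kaehlerMeasure n ħ) ↔ Integrable (fun x : RSpace n × RSpace n =>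
      (Real.exp (-‖x.2‖ ^ 2 / ħ) : ℂ) * g (phasePoint x)) := by
  rw [kaehlerMeasure, integrable_map_measure hg.aestronglyMeasurable
    continuous_phasePoint.aemeasurable,
    integrable_withDensity_iff_integrable_smul' (by fun_prop) (by simp)]
  refine integrable_congr (Eventually.of_forall fun x => ?_)
  simp only [Function.comp]
  rw [ENNReal.toReal_ofReal (Real.exp_pos _).le, Complex.real_smul]

/-- The norm of `HolL2` comes from `innerCore`, so it is matched with the `Lp` norm by comparing
inner products. -/
theorem HolL2.norm_sq_eq (F : HolL2 n ħ) :
    ‖F‖ ^ 2 = (∫⁻ x, ‖weighted ħ F x‖ₑ ^ 2).toReal := by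
  rw [← lintegral_enorm_sq_kaehlerMeasure F.differentiable.continuous, ← eLpNorm_two_sq,
    ENNReal.toReal_pow, ← Lp.norm_toLp _ F.memLp]
  rw [← inner_self_eq_norm_sq (𝕜 := ℂ), ← inner_self_eq_norm_sq (𝕜 := ℂ), HolL2.inner_def,
    L2.inner_def]
  congr 1
  refine integral_congr_ae ?_
  filter_upwards [F.memLp.coeFn_toLp] with z hz
  rw [hz, RCLike.inner_apply, mul_comm]

end KaehlerMeasure

/-! ### The Gaussian transform on the Fourier side -/

section Transform

variable {n : ℕ} {ħ : ℝ}

theorem integrable_gaussKernel_mul (hħ : 0 < ħ) (z : CSpace n) (f : L2R n) :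
    Integrable (fun q => gaussKernel ħ z q * f q) :=
  (memLp_gaussKernel hħ z).integrable_mul (Lp.memLp f)

/-- The Gaussian integral transform `a ∫ exp (-(z - q)² / 2ħ) f q dq`. -/
noncomputable def gaussTransform (ħ : ℝ) (f : RSpace n → ℂ) (z : CSpace n) : ℂ :=
  (((Real.pi * ħ) ^ (-(n : ℝ) / 2) : ℝ) : ℂ) * ∫ q : RSpace n, gaussKernel ħ z q * f q

/-- The Gaussian `exp (-|p + 2πħξ|² / 2ħ)`. -/
noncomputable def shiftedGauss (ħ : ℝ) (p ξ : RSpace n) : ℝ :=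
  Real.exp (-‖p + (2 * Real.pi * ħ) • ξ‖ ^ 2 / (2 * ħ))

theorem conj_gaussKernel (z : CSpace n) (q : RSpace n) :
    conj (gaussKernel ħ (fun k => conj (z k)) q) = gaussKernel ħ z q := by
  rw [gaussKernel, ← Complex.exp_conj]
  simp [gaussKernel, Complex.conj_ofNat]

/-- This is Parseval: conjugating the centre turns the bilinear integral into an `L²` inner product.
-/
theorem integral_gaussKernel_mul_eq (hħ : 0 < ħ) (z : CSpace n) (f : L2R n) :
    ∫ q, gaussKernel ħ z q * f q = (((2 * Real.pi * ħ) ^ ((n : ℝ) / 2) : ℝ) : ℂ) *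
      ∫ ξ, Complex.exp ((2 * Real.pi * Complex.I) * ∑ k, z k * ξ k
        - 2 * Real.pi ^ 2 * ħ * ∑ k, (ξ k : ℂ) ^ 2) * (𝓕 f : L2R n) ξ := by
  set v : CSpace n := fun k => conj (z k)
  have h1 : ∫ q, gaussKernel ħ z q * f q = ⟪(memLp_gaussKernel hħ v).toLp _, f⟫_ℂ := by
    rw [L2.inner_def]
    refine integral_congr_ae ?_
    filter_upwards [(memLp_gaussKernel hħ v).coeFn_toLp] with q hq
    rw [hq, RCLike.inner_apply, conj_gaussKernel, mul_comm]
  rw [h1, ← Lp.inner_fourier_eq, L2.inner_def, ← integral_const_mul]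
  refine integral_congr_ae ?_
  filter_upwards [fourier_toLp_ae_eq (integrable_gaussKernel hħ v) (memLp_gaussKernel hħ v)]
    with ξ hξ
  rw [hξ, RCLike.inner_apply, fourier_gaussKernel hħ, map_mul, Complex.conj_ofReal,
    ← Complex.exp_conj, mul_comm, mul_assoc]
  congr 3
  simp [v, Complex.conj_ofNat]

/-- With `z = q + ip`, the real terms `-2π p·ξ`, `-2π²ħ|ξ|²` and the weight exponent `-|p|² / 2ħ`
combine into the perfect square `-|p + 2πħξ|² / 2ħ`; only the character `exp (2πi q·ξ)` remains. -/
theorem weighted_gaussTransform_eq (hħ : 0 < ħ) (f : L2R n) (x : RSpace n × RSpace n) :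
    weighted ħ (gaussTransform ħ f) x = (((2 : ℝ) ^ ((n : ℝ) / 2) : ℝ) : ℂ) *
      𝓕⁻ (fun ξ => (shiftedGauss ħ x.2 ξ : ℂ) * (𝓕 f : L2R n) ξ) x.1 := by
  have hc : (ħ : ℂ) ≠ 0 := by exact_mod_cast hħ.ne'
  have ha : (Real.pi * ħ) ^ (-(n : ℝ) / 2) * (2 * Real.pi * ħ) ^ ((n : ℝ) / 2) =
      (2 : ℝ) ^ ((n : ℝ) / 2) := by
    have h0 : 0 < Real.pi * ħ := by positivity
    rw [mul_assoc 2, Real.mul_rpow (by norm_num) h0.le, neg_div, Real.rpow_neg h0.le,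
      mul_left_comm, inv_mul_cancel₀ (Real.rpow_pos_of_pos h0 _).ne', mul_one]
  rw [weighted, gaussTransform, integral_gaussKernel_mul_eq hħ, ← mul_assoc, ← Complex.ofReal_mul,
    ha, mul_assoc, ← integral_mul_const, Real.fourierInv_eq']
  congr 2
  funext ξ
  rw [smul_eq_mul, mul_right_comm, shiftedGauss, ← mul_assoc]
  congr 1
  rw [Complex.ofReal_exp, Complex.ofReal_exp, ← Complex.exp_add, ← Complex.exp_add]
  congr 1
  rw [norm_add_sq_real, norm_smul, mul_pow, inner_smul_right]
  have h1 : ((⟪ξ, x.1⟫_ℝ : ℝ) : ℂ) = ∑ k, (x.1 k : ℂ) * ξ k := by simp [PiLp.inner_apply]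
  have h2 : ((⟪x.2, ξ⟫_ℝ : ℝ) : ℂ) = ∑ k, (x.2 k : ℂ) * ξ k := by
    simp [PiLp.inner_apply, mul_comm]
  have h3 : ∑ k, phasePoint x k * (ξ k : ℂ) =
      ∑ k, (x.1 k : ℂ) * ξ k + Complex.I * ∑ k, (x.2 k : ℂ) * ξ k := by
    simp [phasePoint, add_mul, Finset.sum_add_distrib, Finset.mul_sum, mul_assoc]
  rw [h3, ← ofReal_norm_sq_eq_sum]
  rw [Real.norm_eq_abs, sq_abs]
  push_cast
  rw [h1, h2]
  field_simp
  linear_combination (4 * Real.pi * ħ * ∑ k, (x.2 k : ℂ) * ξ k) * Complex.I_sq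

end Transform

/-! ### Holomorphy of the transform -/

section Holomorphic

variable {n : ℕ} {ħ : ℝ}

theorem norm_sum_mul_le (z : CSpace n) (q : RSpace n) :
    ‖∑ k, z k * (q k : ℂ)‖ ≤ n * ‖z‖ * ‖q‖ := by
  refine (norm_sum_le _ _).trans ?_
  calc ∑ k, ‖z k * (q k : ℂ)‖ ≤ ∑ _k : Fin n, ‖z‖ * ‖q‖ := by
        refine Finset.sum_le_sum fun k _ => ?_
        rw [norm_mul, Complex.norm_real]
        exact mul_le_mul (norm_le_pi_norm z k) (PiLp.norm_apply_le q k) (norm_nonneg _)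
          (norm_nonneg _)
    _ = n * ‖z‖ * ‖q‖ := by simp [mul_assoc]

/-- The linear form `z ↦ ∑ z_k q_k` on `ℂⁿ`. -/
noncomputable def dotForm (q : RSpace n) : CSpace n →L[ℂ] ℂ :=
  ∑ k, (q k : ℂ) • ContinuousLinearMap.proj k

theorem dotForm_apply (q : RSpace n) (z : CSpace n) : dotForm q z = ∑ k, z k * (q k : ℂ) := by
  simp [dotForm, mul_comm]

theorem continuous_dotForm : Continuous (dotForm (n := n)) := by
  unfold dotForm
  fun_prop

theorem norm_dotForm_le (q : RSpace n) : ‖dotForm q‖ ≤ n * ‖q‖ := by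
  refine ContinuousLinearMap.opNorm_le_bound _ (by positivity) fun z => ?_
  rw [dotForm_apply]
  linarith [norm_sum_mul_le z q]

/-- With the entire factor `exp (-z² / 2ħ)` pulled out, `z` meets `q` only through a linear form,
which is easy to differentiate and bound under the integral. -/
theorem gaussKernel_eq_dotForm (z : CSpace n) (q : RSpace n) :
    gaussKernel ħ z q = Complex.exp (-(∑ k, z k ^ 2) / (2 * ħ)) *
      (Complex.exp (dotForm q z / ħ) * (Real.exp (-‖q‖ ^ 2 / (2 * ħ)) : ℂ)) := by
  have h1 : ∑ k, z k / ħ * (q k : ℂ) = (∑ k, z k * (q k : ℂ)) / ħ := by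
    rw [Finset.sum_div]
    exact Finset.sum_congr rfl fun k _ => by ring
  rw [gaussKernel_eq, Complex.ofReal_exp, ← Complex.exp_add _ (Complex.ofReal _), dotForm_apply,
    h1, ← ofReal_norm_sq_eq_sum]
  push_cast
  congr 2
  ring

theorem integrable_rexp_neg_norm_sq {b : ℝ} (hb : 0 < b) :
    Integrable (fun q : RSpace n => Real.exp (-b * ‖q‖ ^ 2)) := by
  have := (integrable_cexp_quadratic_rspace (n := n) (b := b) (by simpa using hb) 0).norm
  refine this.congr (Eventually.of_forall fun q => ?_)
  simp only [Pi.zero_apply, zero_mul, Finset.sum_const_zero, add_zero]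
  rw [← ofReal_norm_sq_eq_sum, Complex.norm_exp]
  congr 1
  rw [← Complex.ofReal_neg, ← Complex.ofReal_mul, Complex.ofReal_re]

theorem memLp_exp_norm_mul_gauss (hħ : 0 < ħ) (c : ℝ) :
    MemLp (fun q : RSpace n => Real.exp (c * ‖q‖) * Real.exp (-‖q‖ ^ 2 / (2 * ħ))) 2 := by
  rw [memLp_two_iff_integrable_sq (by fun_prop)]
  have hb : 0 < 1 / (2 * ħ) := by positivity
  -- The constant `exp (2ħc²)` comes from completing the square, at the price of half of the
  -- Gaussian decay.
  refine ((integrable_rexp_neg_norm_sq (n := n) hb).const_mul (Real.exp (2 * ħ * c ^ 2))).mono'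
    (by fun_prop) (Eventually.of_forall fun q => ?_)
  rw [Real.norm_of_nonneg (by positivity), ← Real.exp_add, ← Real.exp_add, ← Real.exp_nat_mul]
  refine Real.exp_le_exp.2 ?_
  have : 2 * ħ * c ^ 2 + -(1 / (2 * ħ)) * ‖q‖ ^ 2 -
      ((2 : ℕ) : ℝ) * (c * ‖q‖ + -‖q‖ ^ 2 / (2 * ħ)) = (‖q‖ - 2 * ħ * c) ^ 2 / (2 * ħ) := by
    push_cast
    field_simp
    ring
  have h2 : 0 ≤ (‖q‖ - 2 * ħ * c) ^ 2 / (2 * ħ) := by positivity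
  linarith

theorem differentiable_gaussTransform (hħ : 0 < ħ) (f : L2R n) :
    Differentiable ℂ (gaussTransform ħ f) := by
  set h : RSpace n → ℂ := fun q => (Real.exp (-‖q‖ ^ 2 / (2 * ħ)) : ℂ) * f q with hh
  have hfm : AEStronglyMeasurable (f : RSpace n → ℂ) volume := (Lp.memLp f).1
  have hm : AEStronglyMeasurable h volume :=
    AEStronglyMeasurable.mul (by fun_prop) hfm
  have hint : ∀ c : ℝ, Integrable (fun q => Real.exp (c * ‖q‖) * ‖h q‖) := fun c => by
    refine ((memLp_exp_norm_mul_gauss hħ c).integrable_mul (Lp.memLp f).norm).congr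
      (Eventually.of_forall fun q => ?_)
    simp only [hh, Pi.mul_apply, norm_mul, Complex.norm_real, Real.norm_eq_abs, Real.abs_exp]
    ring
  have hexp : ∀ z q, ‖Complex.exp (dotForm q z / ħ)‖ ≤ Real.exp (n * ‖z‖ / ħ * ‖q‖) := fun z q => by
    refine (Complex.norm_exp_le_exp_norm _).trans (Real.exp_le_exp.2 ?_)
    rw [norm_div, Complex.norm_real, Real.norm_of_nonneg hħ.le, dotForm_apply, div_mul_eq_mul_div]
    exact div_le_div_of_nonneg_right (norm_sum_mul_le z q) hħ.le
  have hcont : ∀ z, Continuous fun q : RSpace n => Complex.exp (dotForm q z / ħ) := fun z => by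
    have : Continuous fun q : RSpace n => dotForm q z :=
      (ContinuousLinearMap.apply ℂ ℂ z).continuous.comp continuous_dotForm
    fun_prop
  have hd : Differentiable ℂ fun z : CSpace n => ∫ q, Complex.exp (dotForm q z / ħ) * h q := by
    intro z₀
    refine (hasFDerivAt_integral_of_dominated_of_fderiv_le (𝕜 := ℂ) (μ := volume)
      (F := fun z q => Complex.exp (dotForm q z / ħ) * h q)
      (F' := fun z q => (Complex.exp (dotForm q z / ħ) * h q / ħ) • dotForm q)
      -- On the unit ball around `z₀` one has `‖z‖ ≤ ‖z₀‖ + 1`; the extra `n / ħ` absorbs the factor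
      -- `‖dotForm q‖ / ħ` of the derivative via `t ≤ exp t`.
      (bound := fun q => Real.exp ((n * (‖z₀‖ + 1) / ħ + n / ħ) * ‖q‖) * ‖h q‖)
      (Metric.ball_mem_nhds z₀ one_pos) ?_ ?_ ?_ ?_ (hint _) ?_).differentiableAt
    · exact Eventually.of_forall fun z => (hcont z).aestronglyMeasurable.mul hm
    · refine (hint (n * ‖z₀‖ / ħ)).mono' ((hcont z₀).aestronglyMeasurable.mul hm)
        (Eventually.of_forall fun q => ?_)
      rw [norm_mul]
      exact mul_le_mul_of_nonneg_right (hexp z₀ q) (norm_nonneg _)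
    · refine AEStronglyMeasurable.smul (𝕜 := ℂ) ?_ continuous_dotForm.aestronglyMeasurable
      simp_rw [div_eq_mul_inv _ (ħ : ℂ)]
      exact (((hcont z₀).aestronglyMeasurable.mul hm).mul_const _)
    · refine Eventually.of_forall fun q z hz => ?_
      have hz' : ‖z‖ ≤ ‖z₀‖ + 1 := by
        have := norm_sub_norm_le z z₀
        rw [Metric.mem_ball, dist_eq_norm] at hz
        linarith
      rw [norm_smul, norm_div, norm_mul, Complex.norm_real, Real.norm_of_nonneg hħ.le, add_mul,
        Real.exp_add]
      have h1 : ‖Complex.exp (dotForm q z / ħ)‖ ≤ Real.exp (n * (‖z₀‖ + 1) / ħ * ‖q‖) :=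
        (hexp z q).trans (Real.exp_le_exp.2 (by gcongr))
      have h2 : ‖dotForm q‖ / ħ ≤ Real.exp (n / ħ * ‖q‖) := by
        have := Real.add_one_le_exp (n / ħ * ‖q‖)
        have h3 : ‖dotForm q‖ / ħ ≤ n / ħ * ‖q‖ := by
          rw [div_mul_eq_mul_div]
          exact div_le_div_of_nonneg_right (norm_dotForm_le q) hħ.le
        linarith
      calc _ = ‖Complex.exp (dotForm q z / ħ)‖ * (‖dotForm q‖ / ħ) * ‖h q‖ := by ring
        _ ≤ _ := by gcongr
    · refine Eventually.of_forall fun q z _ => ?_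
      have h1 : HasFDerivAt (fun z => dotForm q z / (ħ : ℂ)) ((ħ : ℂ)⁻¹ • dotForm q) z := by
        simp_rw [div_eq_inv_mul]
        exact (dotForm q).hasFDerivAt.const_mul _
      convert! h1.cexp.mul_const (h q) using 1
      ext v
      simp
      ring
  have heq : gaussTransform ħ f = fun z => (((Real.pi * ħ) ^ (-(n : ℝ) / 2) : ℝ) : ℂ) *
      (Complex.exp (-(∑ k, z k ^ 2) / (2 * ħ)) *
        ∫ q, Complex.exp (dotForm q z / ħ) * h q) := by
    funext z
    rw [gaussTransform, ← integral_const_mul (Complex.exp _)]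
    congr 2
    funext q
    rw [gaussKernel_eq_dotForm, hh]
    ring
  rw [heq]
  refine (differentiable_const _).mul (Differentiable.mul ?_ hd)
  fun_prop

end Holomorphic

/-! ### The transform is a multiple of an isometry -/

section Isometry

variable {n : ℕ} {ħ : ℝ}

theorem continuous_shiftedGauss :
    Continuous fun x : RSpace n × RSpace n => shiftedGauss ħ x.1 x.2 := by
  unfold shiftedGauss
  fun_prop

theorem shiftedGauss_sq (p ξ : RSpace n) :
    shiftedGauss ħ p ξ ^ 2 = Real.exp (-(1 / ħ) * ‖p + (2 * Real.pi * ħ) • ξ‖ ^ 2) := by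
  rw [shiftedGauss, exp_half_sq]
  congr 1
  ring

theorem memLp_shiftedGauss (hħ : 0 < ħ) (p : RSpace n) : MemLp (shiftedGauss ħ p) 2 := by
  have hc : Continuous fun ξ => shiftedGauss ħ p ξ := by
    unfold shiftedGauss
    fun_prop
  rw [memLp_two_iff_integrable_sq hc.aestronglyMeasurable]
  simp_rw [shiftedGauss_sq]
  have h1 : Integrable fun ξ : RSpace n => Real.exp (-(1 / ħ) * ‖p + ξ‖ ^ 2) :=
    (integrable_rexp_neg_norm_sq (n := n) (one_div_pos.2 hħ)).comp_add_left p
  have h2 : 2 * Real.pi * ħ ≠ 0 := by positivity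
  exact (integrable_comp_smul_iff volume
    (fun ξ : RSpace n => Real.exp (-(1 / ħ) * ‖p + ξ‖ ^ 2)) h2).2 h1

theorem shiftedGauss_pos (p ξ : RSpace n) : 0 < shiftedGauss ħ p ξ := Real.exp_pos _

theorem shiftedGauss_le_one (hħ : 0 < ħ) (p ξ : RSpace n) : shiftedGauss ħ p ξ ≤ 1 := by
  refine Real.exp_le_one_iff.2 ?_
  rw [neg_div]
  exact neg_nonpos.2 (by positivity)

theorem integrable_shiftedGauss_mul (hħ : 0 < ħ) (p : RSpace n) (φ : L2R n) :
    Integrable (fun ξ => (shiftedGauss ħ p ξ : ℂ) * φ ξ) :=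
  (memLp_shiftedGauss hħ p).ofReal.integrable_mul (Lp.memLp φ)

theorem memLp_shiftedGauss_mul (hħ : 0 < ħ) (p : RSpace n) (φ : L2R n) :
    MemLp (fun ξ => (shiftedGauss ħ p ξ : ℂ) * φ ξ) 2 := by
  refine (Lp.memLp φ).mono ((memLp_shiftedGauss hħ p).ofReal.1.mul (Lp.memLp φ).1)
    (Eventually.of_forall fun ξ => ?_)
  rw [norm_mul, Complex.norm_real, Real.norm_of_nonneg (shiftedGauss_pos p ξ).le]
  exact mul_le_of_le_one_left (norm_nonneg _) (shiftedGauss_le_one hħ p ξ)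

theorem enorm_ofReal_sq {r : ℝ} (hr : 0 ≤ r) : ‖(r : ℂ)‖ₑ ^ 2 = ENNReal.ofReal (r ^ 2) := by
  rw [ENNReal.ofReal_pow hr, ← ofReal_norm, Complex.norm_real, Real.norm_of_nonneg hr]

theorem lintegral_shiftedGauss_sq (hħ : 0 < ħ) (ξ : RSpace n) :
    ∫⁻ p : RSpace n, ‖(shiftedGauss ħ p ξ : ℂ)‖ₑ ^ 2 =
      ENNReal.ofReal ((Real.pi * ħ) ^ ((n : ℝ) / 2)) := by
  simp_rw [enorm_ofReal_sq (shiftedGauss_pos _ ξ).le, shiftedGauss_sq]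
  rw [lintegral_add_right_eq_self
      (fun p : RSpace n => ENNReal.ofReal (Real.exp (-(1 / ħ) * ‖p‖ ^ 2))),
    ← ofReal_integral_eq_lintegral_ofReal (integrable_rexp_neg_norm_sq (one_div_pos.2 hħ))
      (Eventually.of_forall fun _ => (Real.exp_pos _).le),
    GaussianFourier.integral_rexp_neg_mul_sq_norm (one_div_pos.2 hħ)]
  simp

/-- Plancherel on each slice, then Tonelli: the inner integral over `p` is translation-invariant,
hence the same for all `ξ`, and `2^n (πħ)^(n/2) = (4πħ)^(n/2)`. -/
theorem lintegral_weighted_gaussTransform (hħ : 0 < ħ) (f : L2R n) :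
    ∫⁻ x, ‖weighted ħ (gaussTransform ħ f) x‖ₑ ^ 2 =
      ENNReal.ofReal ((4 * Real.pi * ħ) ^ ((n : ℝ) / 2)) * ‖f‖ₑ ^ 2 := by
  have hc := continuous_weighted (ħ := ħ) (differentiable_gaussTransform hħ f).continuous
  set φ : L2R n := 𝓕 f with hφ
  have hφm : AEStronglyMeasurable (φ : RSpace n → ℂ) volume := (Lp.memLp φ).1
  have hm : AEMeasurable (fun x : RSpace n × RSpace n =>
      ‖(shiftedGauss ħ x.1 x.2 : ℂ)‖ₑ ^ 2 * ‖φ x.2‖ₑ ^ 2)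
      ((volume : Measure (RSpace n)).prod volume) := by
    refine AEMeasurable.mul ?_ ((hφm.comp_snd (μ := volume)).enorm.pow_const 2)
    have := continuous_shiftedGauss (n := n) (ħ := ħ)
    exact Continuous.aemeasurable (by fun_prop)
  have h2 : ENNReal.ofReal ((4 * Real.pi * ħ) ^ ((n : ℝ) / 2)) =
      ‖(((2 : ℝ) ^ ((n : ℝ) / 2) : ℝ) : ℂ)‖ₑ ^ 2 *
        ENNReal.ofReal ((Real.pi * ħ) ^ ((n : ℝ) / 2)) := by
    rw [enorm_ofReal_sq (by positivity), ← ENNReal.ofReal_mul (by positivity),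
      ← Real.rpow_natCast, ← Real.rpow_mul (by norm_num), mul_comm ((n : ℝ) / 2),
      Real.rpow_mul (by norm_num), ← Real.mul_rpow (by norm_num) (by positivity)]
    congr 2
    norm_num
    ring
  calc ∫⁻ x, ‖weighted ħ (gaussTransform ħ f) x‖ₑ ^ 2
      = ∫⁻ p, ∫⁻ q, ‖weighted ħ (gaussTransform ħ f) (q, p)‖ₑ ^ 2 :=
        lintegral_prod_symm _ (by fun_prop)
    _ = ∫⁻ p, ‖(((2 : ℝ) ^ ((n : ℝ) / 2) : ℝ) : ℂ)‖ₑ ^ 2 *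
          ∫⁻ ξ, ‖(shiftedGauss ħ p ξ : ℂ)‖ₑ ^ 2 * ‖φ ξ‖ₑ ^ 2 := by
        refine lintegral_congr fun p => ?_
        simp_rw [weighted_gaussTransform_eq hħ, enorm_mul, mul_pow]
        rw [lintegral_const_mul' _ _ (by simp), ← hφ, ← eLpNorm_two_sq, eLpNorm_fourierInv_eq
          (integrable_shiftedGauss_mul hħ p φ) (memLp_shiftedGauss_mul hħ p φ), eLpNorm_two_sq]
        simp_rw [enorm_mul, mul_pow]
    _ = ‖(((2 : ℝ) ^ ((n : ℝ) / 2) : ℝ) : ℂ)‖ₑ ^ 2 *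
          ∫⁻ ξ, (∫⁻ p, ‖(shiftedGauss ħ p ξ : ℂ)‖ₑ ^ 2) * ‖φ ξ‖ₑ ^ 2 := by
        rw [lintegral_const_mul' _ _ (by simp), lintegral_lintegral_swap hm]
        congr 2
        funext ξ
        rw [lintegral_mul_const' _ _ (by simp)]
    _ = _ := by
        simp_rw [lintegral_shiftedGauss_sq hħ]
        rw [lintegral_const_mul' _ _ (by simp), ← eLpNorm_two_sq, ← Lp.enorm_def, ← mul_assoc, h2]
        congr 2
        rw [enorm_eq_iff_norm_eq]
        exact Lp.norm_fourier_eq f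

theorem memLp_gaussTransform (hħ : 0 < ħ) (f : L2R n) :
    MemLp (gaussTransform ħ f) 2 (kaehlerMeasure n ħ) := by
  have hc := (differentiable_gaussTransform hħ f).continuous
  rw [memLp_kaehlerMeasure_iff hc,
    memLp_two_iff_lintegral (continuous_weighted hc).aestronglyMeasurable,
    lintegral_weighted_gaussTransform hħ]
  exact ENNReal.mul_lt_top (by simp) (by simp)

/-- The Gaussian transform as an element of the Segal-Bargmann space. -/
noncomputable def gaussTransformHol (hħ : 0 < ħ) (f : L2R n) : HolL2 n ħ :=
  (⟨gaussTransform ħ f, differentiable_gaussTransform hħ f, memLp_gaussTransform hħ f⟩ :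
    holL2Submodule n ħ)

theorem gaussTransformHol_apply (hħ : 0 < ħ) (f : L2R n) (z : CSpace n) :
    gaussTransformHol hħ f z = gaussTransform ħ f z := rfl

theorem norm_gaussTransformHol (hħ : 0 < ħ) (f : L2R n) :
    ‖gaussTransformHol hħ f‖ = (4 * Real.pi * ħ) ^ ((n : ℝ) / 4) * ‖f‖ := by
  have h0 : 0 < 4 * Real.pi * ħ := by positivity
  have h : ‖gaussTransformHol hħ f‖ ^ 2 = ((4 * Real.pi * ħ) ^ ((n : ℝ) / 4) * ‖f‖) ^ 2 := by
    rw [HolL2.norm_sq_eq]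
    have : weighted ħ (gaussTransformHol hħ f) = weighted ħ (gaussTransform ħ f) := rfl
    rw [this, lintegral_weighted_gaussTransform hħ, ENNReal.toReal_mul,
      ENNReal.toReal_ofReal (by positivity), ENNReal.toReal_pow, toReal_enorm, mul_pow,
      ← Real.rpow_natCast (_ ^ _) 2, ← Real.rpow_mul h0.le]
    congr 2
    push_cast
    ring
  exact (pow_left_inj₀ (norm_nonneg _) (by positivity) two_ne_zero).1 h

theorem gaussTransform_congr {f g : RSpace n → ℂ} (h : f =ᵐ[volume] g) (z : CSpace n) :
    gaussTransform ħ f z = gaussTransform ħ g z := by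
  unfold gaussTransform
  congr 1
  refine integral_congr_ae ?_
  filter_upwards [h] with q hq
  rw [hq]

/-- The pairing map as a bounded operator. -/
noncomputable def pairingMap (hħ : 0 < ħ) : L2R n →L[ℂ] HolL2 n ħ :=
  LinearMap.mkContinuous
    { toFun := gaussTransformHol hħ
      map_add' := fun f g => HolL2.ext_fun fun z => by
        rw [HolL2.add_apply, gaussTransformHol_apply, gaussTransformHol_apply,
          gaussTransformHol_apply, gaussTransform_congr (Lp.coeFn_add f g)]
        simp only [gaussTransform, Pi.add_apply, mul_add]
        rw [integral_add (integrable_gaussKernel_mul hħ z f) (integrable_gaussKernel_mul hħ z g),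
          mul_add]
      map_smul' := fun c f => HolL2.ext_fun fun z => by
        rw [RingHom.id_apply, HolL2.smul_apply, gaussTransformHol_apply, gaussTransformHol_apply,
          gaussTransform_congr (Lp.coeFn_smul c f)]
        simp only [gaussTransform, Pi.smul_apply, smul_eq_mul, mul_left_comm _ c]
        rw [integral_const_mul, mul_left_comm] }
    ((4 * Real.pi * ħ) ^ ((n : ℝ) / 4)) fun f => (norm_gaussTransformHol hħ f).le

theorem pairingMap_apply (hħ : 0 < ħ) (f : L2R n) (z : CSpace n) :
    pairingMap hħ f z = gaussTransform ħ f z := rfl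

theorem norm_pairingMap (hħ : 0 < ħ) (f : L2R n) :
    ‖pairingMap hħ f‖ = (4 * Real.pi * ħ) ^ ((n : ℝ) / 4) * ‖f‖ :=
  norm_gaussTransformHol hħ f

/-- The pairing map, normalized to an isometry. -/
noncomputable def pairingIsometry (hħ : 0 < ħ) : L2R n →ₗᵢ[ℂ] HolL2 n ħ where
  toLinearMap := (((4 * Real.pi * ħ) ^ (-(n : ℝ) / 4) : ℝ) : ℂ) • (pairingMap hħ).toLinearMap
  norm_map' f := by
    have h0 : 0 < 4 * Real.pi * ħ := by positivity
    rw [LinearMap.smul_apply, ContinuousLinearMap.coe_coe, norm_smul, norm_pairingMap,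
      Complex.norm_real, Real.norm_of_nonneg (by positivity), ← mul_assoc, ← Real.rpow_add h0]
    simp [neg_div]

theorem pairingIsometry_apply (hħ : 0 < ħ) (f : L2R n) :
    pairingIsometry hħ f = (((4 * Real.pi * ħ) ^ (-(n : ℝ) / 4) : ℝ) : ℂ) • pairingMap hħ f := rfl

end Isometry

/-! ### Mean value property and coherent states -/

section MeanValue

variable {n : ℕ} {ħ : ℝ}

theorem measurePreserving_phasePoint :
    MeasurePreserving (phasePoint (n := n)) volume volume := by
  have h1 := (EuclideanSpace.volume_preserving_symm_measurableEquiv_toLp (Fin n)).prod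
    (EuclideanSpace.volume_preserving_symm_measurableEquiv_toLp (Fin n))
  have h2 := (volume_measurePreserving_arrowProdEquivProdArrow ℝ ℝ (Fin n)).symm
  have h3 := volume_preserving_pi
    fun _ : Fin n => Complex.volume_preserving_equiv_real_prod.symm
  convert! (h3.comp (h2.comp h1)) using 1
  funext x k
  apply Complex.ext <;> simp [phasePoint] <;> rfl

theorem injective_phasePoint : Function.Injective (phasePoint (n := n)) := by
  intro x y h
  have hk : ∀ k, x.1 k = y.1 k ∧ x.2 k = y.2 k := fun k => by
    have := congrFun h k
    constructor
    · simpa [phasePoint] using congrArg Complex.re this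
    · simpa [phasePoint] using congrArg Complex.im this
  exact Prod.ext (PiLp.ext fun k => (hk k).1) (PiLp.ext fun k => (hk k).2)

theorem measurableEmbedding_phasePoint : MeasurableEmbedding (phasePoint (n := n)) :=
  continuous_phasePoint.measurableEmbedding injective_phasePoint

theorem measurePreserving_circle_smul (c : Circle) :
    MeasurePreserving (fun z : CSpace n => (c : ℂ) • z) volume volume :=
  volume_preserving_pi fun _ : Fin n => (rotation c).measurePreserving

theorem measurableEmbedding_circle_smul (c : Circle) :
    MeasurableEmbedding (fun z : CSpace n => (c : ℂ) • z) :=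
  (Homeomorph.smulOfNeZero (c : ℂ) c.coe_ne_zero).measurableEmbedding

/-- Invariance under the scalar circle suffices. Averaging over `u ↦ exp (iθ) u` leaves the integral
unchanged, while the one-variable mean value property on the complex line through `u` replaces `H u`
by `H 0`. -/
theorem integral_mul_radial_eq {H ρ : CSpace n → ℂ} (hH : Differentiable ℂ H)
    (hρ : Continuous ρ) (hrot : ∀ (c : Circle) (u : CSpace n), ρ ((c : ℂ) • u) = ρ u)
    (hint : Integrable (fun u => H u * ρ u)) :
    ∫ u, H u * ρ u = H 0 * ∫ u, ρ u := by
  have hHc := hH.continuous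
  have hi : ∀ θ : ℝ, Integrable (fun u => H (circleMap 0 1 θ • u) * ρ u) ∧
      ∫ u, H (circleMap 0 1 θ • u) * ρ u = ∫ u, H u * ρ u ∧
      ∫ u, ‖H (circleMap 0 1 θ • u) * ρ u‖ = ∫ u, ‖H u * ρ u‖ := fun θ => by
    have hc : circleMap 0 1 θ = (Circle.exp θ : ℂ) := by simp [circleMap, Circle.coe_exp]
    have he : (fun u => H (circleMap 0 1 θ • u) * ρ u) =
        (fun u => H u * ρ u) ∘ fun u => (Circle.exp θ : ℂ) • u := by
      funext u
      simp only [Function.comp, hrot, hc]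
    have hmp := measurePreserving_circle_smul (n := n) (Circle.exp θ)
    have hme := measurableEmbedding_circle_smul (n := n) (Circle.exp θ)
    refine ⟨?_, ?_, ?_⟩
    · rw [he]
      exact (hmp.integrable_comp_emb hme).2 hint
    · rw [he]
      exact hmp.integral_comp hme (fun u => H u * ρ u)
    · have := hmp.integral_comp hme (fun u => ‖H u * ρ u‖)
      rw [← this]
      exact integral_congr_ae (Eventually.of_forall fun u => congrArg norm (congrFun he u))
  have : IsFiniteMeasure (volume.restrict (Set.uIoc 0 (2 * Real.pi))) :=
    isFiniteMeasure_restrict.2 (by simp [Set.uIoc])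
  -- Fubini is justified because the `L¹` norm of the rotated integrand does not depend on `θ`.
  have hprod : Integrable (fun x : ℝ × CSpace n => H (circleMap 0 1 x.1 • x.2) * ρ x.2)
      ((volume.restrict (Set.uIoc 0 (2 * Real.pi))).prod volume) := by
    refine (integrable_prod_iff (Continuous.aestronglyMeasurable ?_)).2 ⟨?_, ?_⟩
    · have := continuous_circleMap 0 1
      fun_prop
    · exact Eventually.of_forall fun θ => (hi θ).1
    · simp_rw [fun θ => (hi θ).2.2]
      exact integrable_const _
  have hswap := intervalIntegral_integral_swap (f := fun θ u => H (circleMap 0 1 θ • u) * ρ u)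
    hprod
  simp_rw [fun θ => (hi θ).2.1, intervalIntegral.integral_mul_const] at hswap
  have hmean : ∀ u : CSpace n,
      ∫ θ in (0 : ℝ)..2 * Real.pi, H (circleMap 0 1 θ • u) = 2 * Real.pi * H 0 := fun u => by
    have hd : Differentiable ℂ fun c : ℂ => H (c • u) :=
      hH.comp (differentiable_id.smul_const u)
    have := DiffContOnCl.circleAverage (c := 0) (R := 1) (hd.diffContOnCl (s := Metric.ball 0 |1|))
    rw [Real.circleAverage_def] at this
    rw [zero_smul] at this
    rw [← this, Complex.real_smul, ← mul_assoc]
    push_cast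
    rw [mul_inv_cancel₀ (by simp [Real.pi_ne_zero]), one_mul]
  simp_rw [hmean] at hswap
  rw [intervalIntegral.integral_const, integral_const_mul, Complex.real_smul] at hswap
  push_cast at hswap
  rw [sub_zero, mul_assoc] at hswap
  have hpi : (2 * Real.pi : ℂ) ≠ 0 := by simp [Real.pi_ne_zero]
  refine mul_left_cancel₀ hpi ?_
  linear_combination hswap

/-- The phase-space form of the integral against `exp (-p² / ħ) dq dp` is an integral over `ℂⁿ`. -/
theorem integral_kaehlerMeasure_volume {g : CSpace n → ℂ} (hg : Continuous g) :
    ∫ z, g z ∂(kaehlerMeasure n ħ) =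
      ∫ z : CSpace n, Complex.exp (-(∑ k, ((z k).im : ℂ) ^ 2) / ħ) * g z := by
  rw [integral_kaehlerMeasure hg,
    ← measurePreserving_phasePoint.integral_comp measurableEmbedding_phasePoint]
  refine integral_congr_ae (Eventually.of_forall fun x => ?_)
  simp only [phasePoint]
  rw [Complex.ofReal_exp, Complex.ofReal_div, Complex.ofReal_neg, ofReal_norm_sq_eq_sum]
  simp

theorem integrable_kaehlerMeasure_volume {g : CSpace n → ℂ} (hg : Continuous g) :
    Integrable g (kaehlerMeasure n ħ) ↔
      Integrable fun z : CSpace n => Complex.exp (-(∑ k, ((z k).im : ℂ) ^ 2) / ħ) * g z := by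
  rw [integrable_kaehlerMeasure hg,
    ← measurePreserving_phasePoint.integrable_comp_emb measurableEmbedding_phasePoint]
  refine integrable_congr (Eventually.of_forall fun x => ?_)
  simp only [phasePoint, Function.comp]
  rw [Complex.ofReal_exp, Complex.ofReal_div, Complex.ofReal_neg, ofReal_norm_sq_eq_sum]
  simp

/-- The coherent state `exp (-(z - v)² / 4ħ)`. -/
noncomputable def coherent (ħ : ℝ) (v z : CSpace n) : ℂ :=
  Complex.exp (-(∑ k, (z k - v k) ^ 2) / (4 * (ħ : ℂ)))

/-- Convolving two Gaussians of variance `ħ` gives variance `2ħ`; the factor `(πħ)^(-n/2)` makes the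
constant exactly one. -/
theorem gaussTransform_gaussKernel (hħ : 0 < ħ) (v z : CSpace n) :
    gaussTransform ħ (gaussKernel ħ v) z = coherent ħ v z := by
  have hc : (ħ : ℂ) ≠ 0 := by exact_mod_cast hħ.ne'
  have hb : 0 < (1 / ħ : ℂ).re := by
    have : (1 / ħ : ℂ) = ((1 / ħ : ℝ) : ℂ) := by push_cast; rfl
    rw [this, Complex.ofReal_re]
    positivity
  have h1 : ∀ q, gaussKernel ħ z q * gaussKernel ħ v q =
      Complex.exp (-(∑ k, z k ^ 2 + ∑ k, v k ^ 2) / (2 * ħ)) *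
      Complex.exp (-(1 / ħ : ℂ) * ∑ k, (q k : ℂ) ^ 2 + ∑ k, ((z k + v k) / ħ) * q k) := fun q => by
    have h2 : ∑ k, ((z k + v k) / ħ) * (q k : ℂ) =
        ∑ k, (z k / ħ) * (q k : ℂ) + ∑ k, (v k / ħ) * (q k : ℂ) := by
      rw [← Finset.sum_add_distrib]
      exact Finset.sum_congr rfl fun k _ => by ring
    rw [gaussKernel_eq, gaussKernel_eq, ← Complex.exp_add, ← Complex.exp_add, ← Complex.exp_add,
      ← Complex.exp_add, h2]
    congr 1
    field_simp
    ring
  rw [gaussTransform]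
  simp_rw [h1]
  rw [integral_const_mul, integral_cexp_quadratic_rspace hb]
  have h3 : (((Real.pi * ħ) ^ (-(n : ℝ) / 2) : ℝ) : ℂ) * (Real.pi / (1 / ħ)) ^ ((n : ℂ) / 2) =
      1 := by
    have h0 : 0 < Real.pi * ħ := by positivity
    have : (Real.pi / (1 / ħ) : ℂ) ^ ((n : ℂ) / 2) =
        (((Real.pi * ħ) ^ ((n : ℝ) / 2) : ℝ) : ℂ) := by
      rw [Complex.ofReal_cpow h0.le]
      push_cast
      congr 1
      field_simp
    rw [this, ← Complex.ofReal_mul, ← Real.rpow_add h0]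
    simp [neg_div]
  rw [mul_left_comm _ (Complex.exp _), ← mul_assoc _ _ (Complex.exp _), h3, one_mul,
    ← Complex.exp_add, coherent]
  congr 1
  simp only [← Finset.sum_add_distrib, ← Finset.sum_neg_distrib, Finset.sum_div]
  refine Finset.sum_congr rfl fun k _ => ?_
  field_simp
  ring

theorem continuous_coherent (v : CSpace n) : Continuous (coherent ħ v) := by
  unfold coherent
  fun_prop

/-- With the centre at the conjugate of `w`, the terms `ū²` and those linear in `ū` cancel. What is
left is a holomorphic factor equal to one at `u = 0` and a radial Gaussian. -/
theorem conj_coherent_mul_exp (hħ : 0 < ħ) (w u : CSpace n) :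
    Complex.exp (-(∑ k, ((w k + u k).im : ℂ) ^ 2) / ħ) *
      conj (coherent ħ (fun k => conj (w k)) (w + u)) =
    Complex.exp ((∑ k, (u k ^ 2 + 4 * Complex.I * (w k).im * u k)) / (4 * ħ)) *
      Complex.exp (-(∑ k, u k * conj (u k)) / (2 * ħ)) := by
  have hc : (ħ : ℂ) ≠ 0 := by exact_mod_cast hħ.ne'
  rw [coherent, ← Complex.exp_conj, ← Complex.exp_add, ← Complex.exp_add]
  congr 1
  simp only [map_div₀, map_neg, map_sum, map_pow, map_sub, map_mul, Complex.conj_conj,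
    Complex.conj_ofReal, Complex.conj_ofNat, Pi.add_apply, map_add]
  simp only [← Finset.sum_neg_distrib, Finset.sum_div, ← Finset.sum_add_distrib]
  refine Finset.sum_congr rfl fun k _ => ?_
  have h1 : conj (w k) = w k - 2 * Complex.I * (w k).im := by
    apply Complex.ext
    · simp
    · simp
      ring
  have h2 : conj (u k) = u k - 2 * Complex.I * (u k).im := by
    apply Complex.ext
    · simp
    · simp
      ring
  rw [h1, h2]
  field_simp
  rw [Complex.add_im, Complex.ofReal_add]
  ring_nf
  simp only [Complex.I_sq]
  ring

/-- Coherent states evaluate: after translation by `w` the integral equals `F w` times the nonzero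
mass of a radial Gaussian. -/
theorem eq_zero_of_forall_inner_coherent (hħ : 0 < ħ) (F : HolL2 n ħ) (w : CSpace n)
    (hi : Integrable (fun z => conj (coherent ħ (fun k => conj (w k)) z) * F z)
      (kaehlerMeasure n ħ))
    (h : ∫ z, conj (coherent ħ (fun k => conj (w k)) z) * F z ∂(kaehlerMeasure n ħ) = 0) :
    F w = 0 := by
  have hF := F.differentiable
  have hFc := hF.continuous
  have hcc : Continuous fun z => conj (coherent ħ (fun k => conj (w k)) z) * F z :=
    (Complex.continuous_conj.comp (continuous_coherent _)).mul hFc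
  rw [integral_kaehlerMeasure_volume hcc] at h
  rw [integrable_kaehlerMeasure_volume hcc] at hi
  set H : CSpace n → ℂ := fun u =>
    F (w + u) * Complex.exp ((∑ k, (u k ^ 2 + 4 * Complex.I * (w k).im * u k)) / (4 * ħ)) with hH
  set ρ : CSpace n → ℂ := fun u => Complex.exp (-(∑ k, u k * conj (u k)) / (2 * ħ)) with hρ
  have hHd : Differentiable ℂ H := by
    refine Differentiable.mul (hF.comp (by fun_prop)) (by fun_prop)
  have heq : ∀ u, Complex.exp (-(∑ k, (((w + u) k).im : ℂ) ^ 2) / ħ) *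
      (conj (coherent ħ (fun k => conj (w k)) (w + u)) * F (w + u)) = H u * ρ u := fun u => by
    have := conj_coherent_mul_exp hħ w u
    simp only [hH, hρ, Pi.add_apply]
    rw [← mul_assoc, this]
    ring
  have hi' : Integrable fun u => H u * ρ u := by
    have := hi.comp_add_left w
    simp_rw [heq] at this
    exact this
  have h' : ∫ u, H u * ρ u = 0 := by
    rw [← integral_add_left_eq_self _ w] at h
    simp_rw [heq] at h
    exact h
  rw [integral_mul_radial_eq hHd (by fun_prop) ?_ hi'] at h'
  · have hg : ∀ x : RSpace n × RSpace n, ρ (phasePoint x) =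
        (Real.exp (-(1 / (2 * ħ)) * ‖x.1‖ ^ 2) : ℂ) *
          (Real.exp (-(1 / (2 * ħ)) * ‖x.2‖ ^ 2) : ℂ) := fun x => by
      have h1 : ∑ k, phasePoint x k * conj (phasePoint x k) =
          ∑ k, (x.1 k : ℂ) ^ 2 + ∑ k, (x.2 k : ℂ) ^ 2 := by
        rw [← Finset.sum_add_distrib]
        refine Finset.sum_congr rfl fun k _ => ?_
        simp only [phasePoint, map_add, map_mul, Complex.conj_ofReal, Complex.conj_I]
        linear_combination (-(x.2 k : ℂ) ^ 2) * Complex.I_sq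
      simp only [hρ]
      rw [h1, ← ofReal_norm_sq_eq_sum, ← ofReal_norm_sq_eq_sum, Complex.ofReal_exp,
        Complex.ofReal_exp, ← Complex.exp_add]
      push_cast
      congr 1
      field_simp
      ring
    have hpos : ∫ u, ρ u ≠ 0 := by
      rw [← measurePreserving_phasePoint.integral_comp measurableEmbedding_phasePoint]
      simp_rw [hg]
      rw [Measure.volume_eq_prod, integral_prod_mul
        (fun q : RSpace n => (Real.exp (-(1 / (2 * ħ)) * ‖q‖ ^ 2) : ℂ))
        (fun q : RSpace n => (Real.exp (-(1 / (2 * ħ)) * ‖q‖ ^ 2) : ℂ)), integral_complex_ofReal,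
        GaussianFourier.integral_rexp_neg_mul_sq_norm (by positivity)]
      have : (Real.pi / (1 / (2 * ħ))) ^ ((Module.finrank ℝ (RSpace n) : ℝ) / 2) ≠ 0 :=
        (Real.rpow_pos_of_pos (by positivity) _).ne'
      exact mul_self_ne_zero.2 (by exact_mod_cast this)
    simpa [hH, hpos] using h'
  · intro c u
    simp only [hρ, Pi.smul_apply, smul_eq_mul, map_mul]
    congr 4
    funext k
    have : (c : ℂ) * conj (c : ℂ) = 1 := by
      rw [Complex.mul_conj, Circle.normSq_coe, Complex.ofReal_one]
    linear_combination (u k * conj (u k)) * this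

end MeanValue

/-! ### Surjectivity, the unitary and the adjoint -/

section Unitary

variable {n : ℕ} {ħ : ℝ}

theorem pairingMap_gaussKernel (hħ : 0 < ħ) (v z : CSpace n) :
    pairingMap hħ ((memLp_gaussKernel hħ v).toLp _) z = coherent ħ v z := by
  rw [pairingMap_apply, gaussTransform_congr (memLp_gaussKernel hħ v).coeFn_toLp,
    gaussTransform_gaussKernel hħ]

/-- Totality of the coherent states, used both for surjectivity and for the density of
`pairingDomain`. -/
theorem eq_zero_of_inner_pairingMap_gaussKernel (hħ : 0 < ħ) (F : HolL2 n ħ)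
    (h : ∀ v : CSpace n, ⟪pairingMap hħ ((memLp_gaussKernel hħ v).toLp _), F⟫_ℂ = 0) :
    F = 0 := by
  refine HolL2.ext_fun fun w => ?_
  have hi := HolL2.integrable_conj_mul
    (pairingMap hħ ((memLp_gaussKernel hħ fun k => conj (w k)).toLp _)) F
  have h0 := h fun k => conj (w k)
  rw [HolL2.inner_def] at h0
  simp_rw [pairingMap_gaussKernel] at hi h0
  exact eq_zero_of_forall_inner_coherent hħ F w hi h0

theorem surjective_pairingIsometry (hħ : 0 < ħ) :
    Function.Surjective (pairingIsometry (n := n) hħ) := by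
  set K : Submodule ℂ (HolL2 n ħ) := LinearMap.range (pairingIsometry (n := n) hħ).toLinearMap
    with hK
  -- The range is complete as an isometric image of `L²`, so it has orthogonal projections without
  -- completeness of the ambient space.
  have : CompleteSpace K := by
    have : IsComplete (K : Set (HolL2 n ħ)) := by
      have h := (pairingIsometry (n := n) hħ).isometry.isUniformInducing.isComplete_range
      convert! h using 1
    exact this.completeSpace_coe
  have hbot : Kᗮ = ⊥ := by
    rw [Submodule.eq_bot_iff]
    intro F hF
    refine eq_zero_of_inner_pairingMap_gaussKernel hħ F fun v => ?_
    have h1 := (Submodule.mem_orthogonal K F).1 hF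
      (pairingIsometry hħ ((memLp_gaussKernel hħ v).toLp _)) ⟨_, rfl⟩
    rw [pairingIsometry_apply, inner_smul_left] at h1
    refine (mul_eq_zero.1 h1).resolve_left ?_
    rw [Complex.conj_ofReal]
    refine Complex.ofReal_ne_zero.2 ?_
    exact (Real.rpow_pos_of_pos (by positivity) _).ne'
  have htop := (Submodule.orthogonal_eq_bot_iff (K := K)).1 hbot
  exact LinearMap.range_eq_top.1 htop

/-- The unitary multiple of the pairing map. -/
noncomputable def pairingEquiv (hħ : 0 < ħ) : L2R n ≃ₗᵢ[ℂ] HolL2 n ħ :=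
  LinearIsometryEquiv.ofSurjective (pairingIsometry hħ) (surjective_pairingIsometry hħ)

theorem pairingEquiv_apply (hħ : 0 < ħ) (f : L2R n) :
    pairingEquiv hħ f = (((4 * Real.pi * ħ) ^ (-(n : ℝ) / 4) : ℝ) : ℂ) • pairingMap hħ f := rfl

theorem completeSpace_holL2 (hħ : 0 < ħ) : CompleteSpace (HolL2 n ħ) :=
  (pairingEquiv (n := n) hħ).toIsometryEquiv.completeSpace_iff.1 inferInstance

theorem pairingMap_eq (hħ : 0 < ħ) (f : L2R n) :
    pairingMap hħ f = (((4 * Real.pi * ħ) ^ ((n : ℝ) / 4) : ℝ) : ℂ) • pairingEquiv hħ f := by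
  have h0 : 0 < 4 * Real.pi * ħ := by positivity
  rw [pairingEquiv_apply, smul_smul, ← Complex.ofReal_mul, ← Real.rpow_add h0]
  simp [neg_div]

theorem surjective_pairingMap (hħ : 0 < ħ) : Function.Surjective (pairingMap (n := n) hħ) := by
  intro F
  obtain ⟨f, rfl⟩ := (pairingEquiv hħ).surjective F
  exact ⟨(((4 * Real.pi * ħ) ^ (-(n : ℝ) / 4) : ℝ) : ℂ) • f, by
    rw [map_smul, pairingEquiv_apply]⟩

/-- The adjoint of the pairing map. -/
noncomputable def pairingAdjoint (hħ : 0 < ħ) : HolL2 n ħ →L[ℂ] L2R n :=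
  (((4 * Real.pi * ħ) ^ ((n : ℝ) / 4) : ℝ) : ℂ) •
    ((pairingEquiv hħ).symm.toContinuousLinearEquiv.toContinuousLinearMap)

theorem pairingAdjoint_apply (hħ : 0 < ħ) (F : HolL2 n ħ) :
    pairingAdjoint hħ F =
      (((4 * Real.pi * ħ) ^ ((n : ℝ) / 4) : ℝ) : ℂ) • (pairingEquiv hħ).symm F := rfl

/-- For unitary `U` and real `c`, the adjoint of `c U` is `c U⁻¹`. -/
theorem inner_pairingMap_eq (hħ : 0 < ħ) (F : HolL2 n ħ) (f : L2R n) :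
    ⟪F, pairingMap hħ f⟫_ℂ = ⟪pairingAdjoint hħ F, f⟫_ℂ := by
  rw [pairingMap_eq, pairingAdjoint_apply, inner_smul_right, inner_smul_left, Complex.conj_ofReal]
  congr 1
  conv_lhs => rw [← (pairingEquiv hħ).apply_symm_apply F]
  exact (pairingEquiv hħ).inner_map_map _ _

theorem pairingAdjoint_pairingMap (hħ : 0 < ħ) (f : L2R n) :
    pairingAdjoint hħ (pairingMap hħ f) =
      (((4 * Real.pi * ħ) ^ ((n : ℝ) / 2) : ℝ) : ℂ) • f := by
  have h0 : 0 < 4 * Real.pi * ħ := by positivity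
  rw [pairingAdjoint_apply, pairingMap_eq, map_smul, LinearIsometryEquiv.symm_apply_apply,
    smul_smul, ← Complex.ofReal_mul, ← Real.rpow_add h0]
  congr 3
  ring

end Unitary

/-! ### Truncated fiber integrals as Fourier multipliers -/

section FiberIntegral

variable {n : ℕ} {ħ : ℝ}

/-- The Fourier multiplier of the fiber integral over `‖p‖ ≤ R`. -/
noncomputable def ballMultiplier (ħ R : ℝ) (ξ : RSpace n) : ℝ :=
  ∫ p in Metric.closedBall (0 : RSpace n) R, shiftedGauss ħ p ξ

theorem integrable_shiftedGauss_left (hħ : 0 < ħ) (ξ : RSpace n) :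
    Integrable (fun p => shiftedGauss ħ p ξ) := by
  have h := (integrable_rexp_neg_norm_sq (n := n) (b := 1 / (2 * ħ)) (by positivity)).comp_add_right
    ((2 * Real.pi * ħ) • ξ)
  refine h.congr (Eventually.of_forall fun p => ?_)
  simp only [shiftedGauss]
  congr 1
  ring

theorem integral_shiftedGauss_left (hħ : 0 < ħ) (ξ : RSpace n) :
    ∫ p, shiftedGauss ħ p ξ = (2 * Real.pi * ħ) ^ ((n : ℝ) / 2) := by
  have h1 : ∀ p, shiftedGauss ħ p ξ =
      Real.exp (-(1 / (2 * ħ)) * ‖p + (2 * Real.pi * ħ) • ξ‖ ^ 2) := fun p => by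
    simp only [shiftedGauss]
    congr 1
    ring
  simp_rw [h1]
  rw [integral_add_right_eq_self (fun p : RSpace n => Real.exp (-(1 / (2 * ħ)) * ‖p‖ ^ 2)),
    GaussianFourier.integral_rexp_neg_mul_sq_norm (by positivity)]
  congr 1
  · field_simp
  · simp

theorem ballMultiplier_nonneg (R : ℝ) (ξ : RSpace n) : 0 ≤ ballMultiplier ħ R ξ :=
  integral_nonneg fun p => (shiftedGauss_pos p ξ).le

theorem ballMultiplier_le (hħ : 0 < ħ) (R : ℝ) (ξ : RSpace n) :
    ballMultiplier ħ R ξ ≤ (2 * Real.pi * ħ) ^ ((n : ℝ) / 2) := by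
  rw [← integral_shiftedGauss_left hħ ξ]
  exact setIntegral_le_integral (integrable_shiftedGauss_left hħ ξ)
    (Eventually.of_forall fun p => (shiftedGauss_pos p ξ).le)

theorem tendsto_ballMultiplier (hħ : 0 < ħ) (ξ : RSpace n) :
    Tendsto (fun R => ballMultiplier ħ R ξ) atTop (𝓝 ((2 * Real.pi * ħ) ^ ((n : ℝ) / 2))) := by
  rw [← integral_shiftedGauss_left hħ ξ]
  exact (aecover_closedBall tendsto_id).integral_tendsto_of_countably_generated
    (integrable_shiftedGauss_left hħ ξ)

instance isFiniteMeasure_restrict_closedBall (R : ℝ) :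
    IsFiniteMeasure ((volume : Measure (RSpace n)).restrict (Metric.closedBall 0 R)) :=
  isFiniteMeasure_restrict.2 measure_closedBall_lt_top.ne

/-- Both factors are square-integrable on ball times space: the `ξ`-integral of each square is
independent of `p`, and the ball has finite measure. -/
theorem integrable_prod_shiftedGauss_mul (hħ : 0 < ħ) (R : ℝ) (φ : L2R n) :
    Integrable (fun x : RSpace n × RSpace n => (shiftedGauss ħ x.1 x.2 : ℂ) * φ x.2)
      ((volume.restrict (Metric.closedBall 0 R)).prod volume) := by
  have hcont := continuous_shiftedGauss (n := n) (ħ := ħ)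
  have h1 : MemLp (fun x : RSpace n × RSpace n => shiftedGauss ħ x.1 x.2) 2
      ((volume.restrict (Metric.closedBall 0 R)).prod volume) := by
    rw [memLp_two_iff_integrable_sq hcont.aestronglyMeasurable,
      integrable_prod_iff (by exact (hcont.pow 2).aestronglyMeasurable)]
    refine ⟨Eventually.of_forall fun p => (memLp_shiftedGauss hħ p).integrable_sq, ?_⟩
    have h2 : ∀ p : RSpace n, ∫ ξ, ‖shiftedGauss ħ p ξ ^ 2‖ =
        |((2 * Real.pi * ħ) ^ Module.finrank ℝ (RSpace n))⁻¹| •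
          ∫ q : RSpace n, Real.exp (-(1 / ħ) * ‖q‖ ^ 2) := fun p => by
      rw [← integral_add_left_eq_self (fun q : RSpace n => Real.exp (-(1 / ħ) * ‖q‖ ^ 2)) p,
        ← Measure.integral_comp_smul volume
          (fun q : RSpace n => Real.exp (-(1 / ħ) * ‖p + q‖ ^ 2))]
      refine integral_congr_ae (Eventually.of_forall fun ξ => ?_)
      simp only [shiftedGauss_sq]
      rw [Real.norm_of_nonneg (Real.exp_pos _).le]
    simp_rw [h2]
    exact integrable_const _
  exact h1.ofReal.integrable_mul ((Lp.memLp φ).comp_snd _)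

/-- The Fourier transform of the fiber integral over `‖p‖ ≤ R` of the image of `f`. -/
noncomputable def ballSymbol (ħ R : ℝ) (f : L2R n) (ξ : RSpace n) : ℂ :=
  (((2 : ℝ) ^ ((n : ℝ) / 2) * ballMultiplier ħ R ξ : ℝ) : ℂ) * (𝓕 f : L2R n) ξ

theorem ballSymbol_eq (R : ℝ) (f : L2R n) (ξ : RSpace n) :
    ballSymbol ħ R f ξ = (((2 : ℝ) ^ ((n : ℝ) / 2) : ℝ) : ℂ) *
      ∫ p in Metric.closedBall (0 : RSpace n) R,
        (shiftedGauss ħ p ξ : ℂ) * (𝓕 f : L2R n) ξ := by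
  rw [integral_mul_const, integral_complex_ofReal, ballSymbol, ballMultiplier, Complex.ofReal_mul,
    mul_assoc]

theorem integrable_ballSymbol (hħ : 0 < ħ) (R : ℝ) (f : L2R n) :
    Integrable (ballSymbol ħ R f) := by
  simp_rw [funext (ballSymbol_eq R f)]
  exact (integrable_prod_shiftedGauss_mul hħ R (𝓕 f : L2R n)).integral_prod_right.const_mul _

theorem two_rpow_mul_rpow (hħ : 0 < ħ) :
    (2 : ℝ) ^ ((n : ℝ) / 2) * (2 * Real.pi * ħ) ^ ((n : ℝ) / 2) =
      (4 * Real.pi * ħ) ^ ((n : ℝ) / 2) := by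
  rw [← Real.mul_rpow (by norm_num) (by positivity)]
  congr 1
  ring

theorem two_rpow_mul_ballMultiplier_le (hħ : 0 < ħ) (R : ℝ) (ξ : RSpace n) :
    (2 : ℝ) ^ ((n : ℝ) / 2) * ballMultiplier ħ R ξ ≤ (4 * Real.pi * ħ) ^ ((n : ℝ) / 2) := by
  rw [← two_rpow_mul_rpow hħ]
  exact mul_le_mul_of_nonneg_left (ballMultiplier_le hħ R ξ) (by positivity)

theorem memLp_ballSymbol (hħ : 0 < ħ) (R : ℝ) (f : L2R n) : MemLp (ballSymbol ħ R f) 2 := by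
  refine ((Lp.memLp (𝓕 f : L2R n)).const_mul
    (((4 * Real.pi * ħ) ^ ((n : ℝ) / 2) : ℝ) : ℂ)).mono (integrable_ballSymbol hħ R f).1
    (Eventually.of_forall fun ξ => ?_)
  have h0 : 0 ≤ (2 : ℝ) ^ ((n : ℝ) / 2) * ballMultiplier ħ R ξ :=
    mul_nonneg (by positivity) (ballMultiplier_nonneg R ξ)
  rw [ballSymbol, norm_mul, norm_mul, Complex.norm_real, Complex.norm_real,
    Real.norm_of_nonneg h0, Real.norm_of_nonneg (by positivity)]
  exact mul_le_mul_of_nonneg_right (two_rpow_mul_ballMultiplier_le hħ R ξ) (norm_nonneg _)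

theorem fiberIntegrand_eq_weighted (F : HolL2 n ħ) (q p : RSpace n) :
    fiberIntegrand F q p = weighted ħ F (q, p) := rfl

/-- Truncation to the ball permits exchanging the `p`-integral with the inverse Fourier integral. -/
theorem integral_closedBall_fiberIntegrand (hħ : 0 < ħ) (R : ℝ) (f : L2R n) (q : RSpace n) :
    ∫ p in Metric.closedBall (0 : RSpace n) R, fiberIntegrand (pairingMap hħ f) q p =
      𝓕⁻ (ballSymbol ħ R f) q := by
  have h1 : ∀ p, fiberIntegrand (pairingMap hħ f) q p = (((2 : ℝ) ^ ((n : ℝ) / 2) : ℝ) : ℂ) *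
      𝓕⁻ (fun ξ => (shiftedGauss ħ p ξ : ℂ) * (𝓕 f : L2R n) ξ) q :=
    fun p => weighted_gaussTransform_eq hħ f (q, p)
  have hint : Integrable (Function.uncurry fun p ξ : RSpace n =>
      Complex.exp (((2 * Real.pi * ⟪ξ, q⟫_ℝ : ℝ) : ℂ) * Complex.I) •
        ((shiftedGauss ħ p ξ : ℂ) * (𝓕 f : L2R n) ξ))
      ((volume.restrict (Metric.closedBall 0 R)).prod volume) := by
    refine (integrable_prod_shiftedGauss_mul hħ R (𝓕 f : L2R n)).mono
      (AEStronglyMeasurable.smul (𝕜 := ℂ)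
        (f := fun x : RSpace n × RSpace n =>
          Complex.exp (((2 * Real.pi * ⟪x.2, q⟫_ℝ : ℝ) : ℂ) * Complex.I))
        (Continuous.aestronglyMeasurable (by fun_prop))
        (integrable_prod_shiftedGauss_mul hħ R (𝓕 f : L2R n)).1)
      (Eventually.of_forall fun x => ?_)
    simp only [Function.uncurry, norm_smul, Complex.norm_exp_ofReal_mul_I, one_mul]
    exact le_rfl
  simp_rw [h1, Real.fourierInv_eq', ballSymbol_eq]
  rw [integral_const_mul, integral_integral_swap hint, ← integral_const_mul]
  refine integral_congr_ae (Eventually.of_forall fun ξ => ?_)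
  simp only [smul_eq_mul]
  rw [integral_const_mul]
  ring

theorem memLp_fiberIntegral (hħ : 0 < ħ) (F : HolL2 n ħ) (R : ℝ) :
    MemLp (fun q => ∫ p in Metric.closedBall (0 : RSpace n) R, fiberIntegrand F q p) 2 := by
  obtain ⟨f, rfl⟩ := surjective_pairingMap hħ F
  simp_rw [integral_closedBall_fiberIntegrand hħ]
  refine ⟨(continuous_fourierInv_of_integrable
    (integrable_ballSymbol hħ R f)).aestronglyMeasurable, ?_⟩
  rw [eLpNorm_fourierInv_eq (integrable_ballSymbol hħ R f) (memLp_ballSymbol hħ R f)]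
  exact (memLp_ballSymbol hħ R f).2

theorem eLpNorm_fiberIntegral_sub (hħ : 0 < ħ) (f : L2R n) (R : ℝ) :
    eLpNorm (fun q => (∫ p in Metric.closedBall (0 : RSpace n) R,
      fiberIntegrand (pairingMap hħ f) q p) - pairingAdjoint hħ (pairingMap hħ f) q) 2 volume =
    eLpNorm (fun ξ => (((2 : ℝ) ^ ((n : ℝ) / 2) * ballMultiplier ħ R ξ -
      (4 * Real.pi * ħ) ^ ((n : ℝ) / 2) : ℝ) : ℂ) * (𝓕 f : L2R n) ξ) 2 volume := by
  set c : ℂ := (((4 * Real.pi * ħ) ^ ((n : ℝ) / 2) : ℝ) : ℂ) with hc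
  set S : L2R n := (memLp_ballSymbol hħ R f).toLp _ with hS
  set E := (Lp.fourierTransformₗᵢ (RSpace n) ℂ)
  have hinv : pairingAdjoint hħ (pairingMap hħ f) = E.symm (c • E f) := by
    rw [pairingAdjoint_pairingMap, map_smul, LinearIsometryEquiv.symm_apply_apply]
  have h1 : (fun q => (∫ p in Metric.closedBall (0 : RSpace n) R,
      fiberIntegrand (pairingMap hħ f) q p) - pairingAdjoint hħ (pairingMap hħ f) q) =ᵐ[volume]
      (E.symm (S - c • E f) : L2R n) := by
    rw [hinv, map_sub]
    filter_upwards [Lp.coeFn_sub (E.symm S) (E.symm (c • E f)),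
      fourierInv_toLp_ae_eq (integrable_ballSymbol hħ R f) (memLp_ballSymbol hħ R f)] with q h1 h2
    rw [h1, Pi.sub_apply, integral_closedBall_fiberIntegrand hħ, ← h2]
    rfl
  have h2 : (fun ξ => (((2 : ℝ) ^ ((n : ℝ) / 2) * ballMultiplier ħ R ξ -
      (4 * Real.pi * ħ) ^ ((n : ℝ) / 2) : ℝ) : ℂ) * (𝓕 f : L2R n) ξ) =ᵐ[volume]
      (S - c • E f : L2R n) := by
    filter_upwards [Lp.coeFn_sub S (c • E f), Lp.coeFn_smul c (E f),
      (memLp_ballSymbol hħ R f).coeFn_toLp] with ξ h1 h2 h3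
    rw [h1, Pi.sub_apply, h2, Pi.smul_apply, h3, smul_eq_mul, ballSymbol, Complex.ofReal_sub,
      sub_mul]
    rfl
  rw [eLpNorm_congr_ae h1, eLpNorm_congr_ae h2, ← Lp.enorm_def, ← Lp.enorm_def,
    enorm_eq_iff_norm_eq]
  exact E.symm.norm_map _

theorem tendsto_eLpNorm_fiberIntegral_sub (hħ : 0 < ħ) (F : HolL2 n ħ) :
    Tendsto (fun R : ℝ => eLpNorm (fun q => (∫ p in Metric.closedBall (0 : RSpace n) R,
      fiberIntegrand F q p) - pairingAdjoint hħ F q) 2 volume) atTop (𝓝 0) := by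
  obtain ⟨f, rfl⟩ := surjective_pairingMap hħ F
  simp_rw [eLpNorm_fiberIntegral_sub hħ]
  set φ : L2R n := 𝓕 f
  set M : ℝ := (4 * Real.pi * ħ) ^ ((n : ℝ) / 2) with hM
  have hφm : AEStronglyMeasurable (φ : RSpace n → ℂ) volume := (Lp.memLp φ).1
  have hmeas : ∀ R, StronglyMeasurable fun ξ : RSpace n => ballMultiplier ħ R ξ := fun R =>
    (continuous_shiftedGauss (n := n) (ħ := ħ)).stronglyMeasurable.integral_prod_left
  have key : Tendsto (fun R : ℝ => ∫⁻ ξ, ‖(((2 : ℝ) ^ ((n : ℝ) / 2) * ballMultiplier ħ R ξ -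
      M : ℝ) : ℂ) * φ ξ‖ₑ ^ 2) atTop (𝓝 (∫⁻ _ξ : RSpace n, 0)) := by
    refine tendsto_lintegral_filter_of_dominated_convergence'
      -- The scaled multiplier lies between `0` and its limit `M`, so its distance to `M` is at most
      -- `M`.
      (fun ξ => ‖(M : ℂ) * φ ξ‖ₑ ^ 2) ?_ ?_ ?_ ?_
    · refine Eventually.of_forall fun R => ?_
      exact ((Complex.continuous_ofReal.comp_stronglyMeasurable
        (((hmeas R).const_mul _).sub stronglyMeasurable_const)).aestronglyMeasurable.mul
          hφm).enorm.pow_const 2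
    · refine Eventually.of_forall fun R => Eventually.of_forall fun ξ => ?_
      have h0 : 0 ≤ (2 : ℝ) ^ ((n : ℝ) / 2) * ballMultiplier ħ R ξ :=
        mul_nonneg (by positivity) (ballMultiplier_nonneg R ξ)
      have h1 := two_rpow_mul_ballMultiplier_le hħ R ξ
      gcongr
      rw [enorm_le_iff_norm_le, norm_mul, norm_mul, Complex.norm_real, Complex.norm_real]
      refine mul_le_mul_of_nonneg_right ?_ (norm_nonneg _)
      rw [Real.norm_eq_abs, Real.norm_eq_abs, abs_le, abs_of_nonneg (by positivity)]
      constructor <;> linarith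
    · have := ((memLp_two_iff_lintegral ((Lp.memLp φ).const_mul (M : ℂ)).1).1
        ((Lp.memLp φ).const_mul (M : ℂ)))
      exact this.ne
    · refine Eventually.of_forall fun ξ => ?_
      have h1 : Tendsto (fun R : ℝ => (((2 : ℝ) ^ ((n : ℝ) / 2) * ballMultiplier ħ R ξ -
          M : ℝ) : ℂ) * φ ξ) atTop (𝓝 0) := by
        have h2 := ((tendsto_ballMultiplier hħ ξ).const_mul ((2 : ℝ) ^ ((n : ℝ) / 2))).sub_const M
        rw [two_rpow_mul_rpow hħ, ← hM, sub_self] at h2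
        have h3 := ((Complex.continuous_ofReal.tendsto 0).comp h2).mul_const (φ ξ)
        simpa using h3
      have h4 := ((ENNReal.continuous_pow 2).tendsto _).comp h1.enorm
      simpa using! h4
  simp_rw [← eLpNorm_two_sq] at key
  rw [lintegral_zero] at key
  have := ((ENNReal.continuous_rpow_const (y := 1 / 2)).tendsto 0).comp key
  rw [ENNReal.zero_rpow_of_pos (by norm_num)] at this
  refine this.congr fun R => ?_
  rw [Function.comp, ← ENNReal.rpow_natCast, ← ENNReal.rpow_mul]
  norm_num

end FiberIntegral

/-! ### The pairing, its domain and uniqueness -/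

section Pairing

variable {n : ℕ} {ħ : ℝ}

theorem tendsto_setIntegral_closedBall {α : Type*} [NormedAddCommGroup α] [MeasurableSpace α]
    [OpensMeasurableSpace α] {μ : Measure α} {g : α → ℂ} (hg : Integrable g μ) :
    Tendsto (fun R : ℝ => ∫ x in Metric.closedBall 0 R, g x ∂μ) atTop (𝓝 (∫ x, g x ∂μ)) :=
  (aecover_closedBall tendsto_id).integral_tendsto_of_countably_generated hg

/-- Convergence in `L²` gives almost everywhere convergence along a sequence of radii; where the
fiber is integrable, the same truncations tend to the full integral. -/
theorem ae_pairingAdjoint_eq_integral (hħ : 0 < ħ) (F : HolL2 n ħ) :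
    ∀ᵐ q : RSpace n, Integrable (fiberIntegrand F q) →
      pairingAdjoint hħ F q = ∫ p : RSpace n, fiberIntegrand F q p := by
  have hm := tendstoInMeasure_of_tendsto_eLpNorm (by norm_num)
    (fun R => (memLp_fiberIntegral hħ F R).1) (Lp.memLp (pairingAdjoint hħ F)).1
    (tendsto_eLpNorm_fiberIntegral_sub hħ F)
  obtain ⟨R, hR, hae⟩ := hm.exists_seq_tendsto_ae'
  filter_upwards [hae] with q hq hi
  exact tendsto_nhds_unique hq ((tendsto_setIntegral_closedBall hi).comp hR)

theorem pairingIntegrand_eq (F : HolL2 n ħ) (f : L2R n) (x : RSpace n × RSpace n) :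
    pairingIntegrand F f x = conj (weighted ħ F x) * f x.1 := by
  rw [pairingIntegrand, weighted, map_mul, Complex.conj_ofReal, mul_right_comm]

theorem restrict_univ_prod_closedBall (R : ℝ) :
    (volume : Measure (RSpace n × RSpace n)).restrict (Set.univ ×ˢ Metric.closedBall 0 R) =
      volume.prod (volume.restrict (Metric.closedBall 0 R)) := by
  rw [Measure.volume_eq_prod, ← Measure.prod_restrict, Measure.restrict_univ]

/-- By Cauchy–Schwarz, since `f q` is square-integrable on the region once `p` is confined to a
ball. -/
theorem integrableOn_pairingIntegrand (F : HolL2 n ħ) (f : L2R n) (R : ℝ) :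
    IntegrableOn (pairingIntegrand F f) (Set.univ ×ˢ Metric.closedBall 0 R) := by
  have h1 : MemLp (fun x => conj (weighted ħ F x)) 2
      (volume.restrict ((Set.univ : Set (RSpace n)) ×ˢ Metric.closedBall (0 : RSpace n) R)) :=
    (((memLp_kaehlerMeasure_iff F.differentiable.continuous).1 F.memLp).restrict _).star
  have h2 : MemLp (fun x : RSpace n × RSpace n => f x.1) 2
      (volume.restrict ((Set.univ : Set (RSpace n)) ×ˢ Metric.closedBall (0 : RSpace n) R)) := by
    rw [restrict_univ_prod_closedBall]
    exact (Lp.memLp f).comp_fst _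
  rw [IntegrableOn, funext (pairingIntegrand_eq F f)]
  exact h1.integrable_mul h2

theorem setIntegral_pairingIntegrand (hħ : 0 < ħ) (F : HolL2 n ħ) (f : L2R n) (R : ℝ) :
    ∫ x in Set.univ ×ˢ Metric.closedBall 0 R, pairingIntegrand F f x =
      ⟪(memLp_fiberIntegral hħ F R).toLp _, f⟫_ℂ := by
  have hi := integrableOn_pairingIntegrand F f R
  rw [IntegrableOn, restrict_univ_prod_closedBall] at hi
  rw [restrict_univ_prod_closedBall, integral_prod _ hi, L2.inner_def]
  refine integral_congr_ae ?_
  filter_upwards [(memLp_fiberIntegral hħ F R).coeFn_toLp] with q hq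
  rw [hq, RCLike.inner_apply, ← integral_conj, ← integral_const_mul]
  refine integral_congr_ae (Eventually.of_forall fun p => ?_)
  simp only
  rw [pairingIntegrand_eq, fiberIntegrand_eq_weighted, mul_comm]

theorem hasPairing_pairingMap (hħ : 0 < ħ) (F : HolL2 n ħ) (f : L2R n) :
    HasPairing F f ⟪F, pairingMap hħ f⟫_ℂ := by
  refine ⟨integrableOn_pairingIntegrand F f, ?_⟩
  simp_rw [setIntegral_pairingIntegrand hħ]
  rw [inner_pairingMap_eq]
  refine Tendsto.inner ?_ tendsto_const_nhds
  have h := tendsto_eLpNorm_fiberIntegral_sub hħ F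
  rw [tendsto_iff_edist_tendsto_0]
  refine h.congr fun R => ?_
  rw [Lp.edist_def]
  refine eLpNorm_congr_ae ?_
  filter_upwards [(memLp_fiberIntegral hħ F R).coeFn_toLp] with q hq
  rw [Pi.sub_apply, hq]

theorem HasPairing.eq_integral {F : HolL2 n ħ} {f : L2R n} {c : ℂ} (h : HasPairing F f c)
    (hi : Integrable (pairingIntegrand F f)) : ∫ x, pairingIntegrand F f x = c := by
  have hcover : AECover (volume : Measure (RSpace n × RSpace n)) (atTop : Filter ℝ)
      fun R => Set.univ ×ˢ Metric.closedBall 0 R :=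
    { ae_eventually_mem := Eventually.of_forall fun x => by
        filter_upwards [eventually_ge_atTop ‖x.2‖] with R hR
        simpa using hR
      measurableSet := fun R => MeasurableSet.univ.prod measurableSet_closedBall }
  exact tendsto_nhds_unique (hcover.integral_tendsto_of_countably_generated hi) h.2

theorem representsPairing_pairingMap (hħ : 0 < ħ) :
    RepresentsPairing (pairingMap (n := n) hħ) :=
  fun F f hi => (hasPairing_pairingMap hħ F f).eq_integral hi

/-- The functions whose pairing with every element of `L²` is absolutely convergent. -/
def pairingDomain (n : ℕ) (ħ : ℝ) : Submodule ℂ (HolL2 n ħ) where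
  carrier := {F | ∀ f : L2R n, Integrable (pairingIntegrand F f)}
  add_mem' := fun {F G} hF hG f => by
    refine ((hF f).add (hG f)).congr (Eventually.of_forall fun x => ?_)
    simp only [Pi.add_apply, pairingIntegrand, HolL2.add_apply, map_add]
    ring
  zero_mem' := fun f => by
    refine (integrable_zero _ ℂ volume).congr (Eventually.of_forall fun x => ?_)
    simp [pairingIntegrand, HolL2.zero_apply]
  smul_mem' := fun c F hF f => by
    refine ((hF f).const_mul (conj c)).congr (Eventually.of_forall fun x => ?_)
    simp only [pairingIntegrand, HolL2.smul_apply, map_mul]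
    ring

/-- The only term of the exponent that couples `q` and `p` is purely imaginary, so the modulus
splits into Gaussians in `q` and in `p`; half of the weight survives as decay in `p`. -/
theorem norm_weighted_coherent (hħ : 0 < ħ) (v : CSpace n) (x : RSpace n × RSpace n) :
    ‖weighted ħ (coherent ħ v) x‖ = ‖gaussKernel (2 * ħ) v x.1‖ *
      ‖Complex.exp (-(1 / (2 * (2 * ħ : ℝ)) : ℂ) * ∑ k, (x.2 k : ℂ) ^ 2 +
        ∑ k, (-((v k).im / (2 * ħ) : ℂ)) * x.2 k)‖ := by
  have hc : (ħ : ℂ) ≠ 0 := by exact_mod_cast hħ.ne'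
  have h1 : weighted ħ (coherent ħ v) x = gaussKernel (2 * ħ) v x.1 *
      Complex.exp (-(1 / (2 * (2 * ħ : ℝ)) : ℂ) * ∑ k, (x.2 k : ℂ) ^ 2 +
        ∑ k, (-((v k).im / (2 * ħ) : ℂ)) * x.2 k) *
      Complex.exp (((∑ k, ((v k).re - x.1 k) * x.2 k / (2 * ħ) : ℝ) : ℂ) * Complex.I) := by
    rw [weighted, coherent, gaussKernel, Complex.ofReal_exp, Complex.ofReal_div, Complex.ofReal_neg,
      ofReal_norm_sq_eq_sum, ← Complex.exp_add, ← Complex.exp_add, ← Complex.exp_add]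
    congr 1
    push_cast
    simp only [← Finset.sum_neg_distrib, Finset.sum_div, Finset.mul_sum, Finset.sum_mul,
      ← Finset.sum_add_distrib]
    refine Finset.sum_congr rfl fun k _ => ?_
    have h2 := Complex.re_add_im (v k)
    simp only [phasePoint]
    field_simp
    linear_combination (-8 * Complex.I * (x.2 k : ℂ)) * h2 +
      (8 * (x.2 k : ℂ) * (v k).im - 4 * (x.2 k : ℂ) ^ 2) * Complex.I_sq
  rw [h1, norm_mul, norm_mul, Complex.norm_exp_ofReal_mul_I, mul_one]

theorem pairingMap_gaussKernel_mem (hħ : 0 < ħ) (v : CSpace n) :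
    pairingMap hħ ((memLp_gaussKernel hħ v).toLp _) ∈ pairingDomain n ħ := by
  intro f
  have h2 : 0 < 2 * ħ := by positivity
  have hA : Integrable fun q => ‖gaussKernel (2 * ħ) v q‖ * ‖f q‖ := by
    refine (integrable_gaussKernel_mul h2 v f).norm.congr (Eventually.of_forall fun q => ?_)
    exact norm_mul _ _
  have hB := (integrable_cexp_quadratic_rspace (n := n) (re_one_div_two_mul_pos h2)
    fun k => (-((v k).im / (2 * ħ) : ℂ))).norm
  refine (hA.mul_prod hB).mono' ?_ (Eventually.of_forall fun x => le_of_eq ?_)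
  · rw [funext (pairingIntegrand_eq _ f)]
    exact (Complex.continuous_conj.comp (continuous_weighted
      (HolL2.differentiable _).continuous)).aestronglyMeasurable.mul (Lp.memLp f).1.comp_fst
  · have h3 : weighted ħ (pairingMap hħ ((memLp_gaussKernel hħ v).toLp _)) x =
        weighted ħ (coherent ħ v) x := by
      rw [weighted, weighted, pairingMap_gaussKernel]
    rw [pairingIntegrand_eq, norm_mul, RCLike.norm_conj, h3, norm_weighted_coherent hħ,
      mul_right_comm]

theorem dense_pairingDomain (hħ : 0 < ħ) : Dense (pairingDomain n ħ : Set (HolL2 n ħ)) := by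
  have := completeSpace_holL2 (n := n) hħ
  rw [Submodule.dense_iff_topologicalClosure_eq_top, Submodule.topologicalClosure_eq_top_iff,
    Submodule.eq_bot_iff]
  intro F hF
  exact eq_zero_of_inner_pairingMap_gaussKernel hħ F fun v =>
    (Submodule.mem_orthogonal _ F).1 hF _ (pairingMap_gaussKernel_mem hħ v)

/-- For `F` in the dense domain, both `⟪F, T f⟫` and `⟪F, T' f⟫` equal the same pairing integral,
for every `f`. -/
theorem RepresentsPairing.eq (hħ : 0 < ħ) {T T' : L2R n →L[ℂ] HolL2 n ħ}
    (hT : RepresentsPairing T) (hT' : RepresentsPairing T') : T' = T := by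
  ext f
  refine (dense_pairingDomain hħ).eq_of_inner_right (𝕜 := ℂ) fun F hF => ?_
  rw [← hT F f (hF f), ← hT' F f (hF f)]

theorem normalization_const_eq (hħ : 0 < ħ) :
    (Real.pi * ħ) ^ ((n : ℝ) / 4) * (2 * Real.pi * ħ) ^ (-(n : ℝ) / 2) =
      (4 * Real.pi * ħ) ^ (-(n : ℝ) / 4) := by
  have h0 : 0 < Real.pi * ħ := by positivity
  have h4 : (4 : ℝ) ^ (-(n : ℝ) / 4) = 2 ^ (-(n : ℝ) / 2) := by
    rw [show (4 : ℝ) = 2 ^ (2 : ℝ) by norm_num, ← Real.rpow_mul (by norm_num)]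
    congr 1
    ring
  rw [mul_assoc 2, mul_assoc 4, Real.mul_rpow (by norm_num) h0.le,
    Real.mul_rpow (by norm_num) h0.le, h4, mul_left_comm, ← Real.rpow_add h0]
  congr 2
  ring

end Pairing

theorem mainTheorem4 (n : ℕ) (ħ : ℝ) (hħ : 0 < ħ) :
    -- the pairing integral is absolutely convergent on dense subspaces
    (∃ (D₁ : Submodule ℂ (HolL2 n ħ)) (D₂ : Submodule ℂ (L2R n)),
      Dense (D₁ : Set (HolL2 n ħ)) ∧ Dense (D₂ : Set (L2R n)) ∧
      ∀ F ∈ D₁, ∀ f ∈ D₂, Integrable (pairingIntegrand F f)) ∧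
    ∃ (T : L2R n →L[ℂ] HolL2 n ħ) (Tstar : HolL2 n ħ →L[ℂ] L2R n),
      -- existence and uniqueness of the pairing map `T`, with adjoint `Tstar`
      RepresentsPairing T ∧
      (∀ T' : L2R n →L[ℂ] HolL2 n ħ, RepresentsPairing T' → T' = T) ∧
      (∀ (F : HolL2 n ħ) (f : L2R n), HasPairing F f ⟪F, T f⟫_ℂ) ∧
      (∀ (F : HolL2 n ħ) (f : L2R n), ⟪F, T f⟫_ℂ = ⟪Tstar F, f⟫_ℂ) ∧
      -- the Gaussian integral kernel of `T`
      (∀ (f : L2R n) (z : CSpace n),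
        Integrable (fun q : RSpace n => gaussKernel ħ z q * f q) ∧
        T f z = (((Real.pi * ħ) ^ (-(n : ℝ) / 2) : ℝ) : ℂ) *
          ∫ q : RSpace n, gaussKernel ħ z q * f q) ∧
      -- the adjoint as a fiber integral: as a limit in `L²`, and literally where it converges
      (∀ F : HolL2 n ħ,
        (∀ R : ℝ, MemLp (fun q : RSpace n =>
          ∫ p in Metric.closedBall (0 : RSpace n) R, fiberIntegrand F q p) 2) ∧
        Tendsto (fun R : ℝ => eLpNorm (fun q : RSpace n =>
          (∫ p in Metric.closedBall (0 : RSpace n) R, fiberIntegrand F q p) - Tstar F q)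
          2 volume) atTop (𝓝 0) ∧
        (∀ᵐ q : RSpace n, Integrable (fiberIntegrand F q) →
          Tstar F q = ∫ p : RSpace n, fiberIntegrand F q p)) ∧
      -- unitarity of a constant multiple of `T`
      (∃ U : L2R n ≃ₗᵢ[ℂ] HolL2 n ħ, ∀ f : L2R n,
        U f = (((Real.pi * ħ) ^ ((n : ℝ) / 4) * (2 * Real.pi * ħ) ^ (-(n : ℝ) / 2) : ℝ) : ℂ) •
          T f) := by
  -- Elements of `pairingDomain` pair absolutely with every `f`, so the second dense subspace can be
  -- all of `L²`.
  refine ⟨⟨pairingDomain n ħ, ⊤, dense_pairingDomain hħ, dense_univ, fun F hF f _ => hF f⟩,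
    pairingMap hħ, pairingAdjoint hħ, representsPairing_pairingMap hħ,
    fun T' hT' => (representsPairing_pairingMap hħ).eq hħ hT', hasPairing_pairingMap hħ,
    inner_pairingMap_eq hħ, fun f z => ⟨integrable_gaussKernel_mul hħ z f, rfl⟩,
    fun F => ⟨memLp_fiberIntegral hħ F, tendsto_eLpNorm_fiberIntegral_sub hħ F,
      ae_pairingAdjoint_eq_integral hħ F⟩, pairingEquiv hħ, fun f => ?_⟩
  rw [normalization_const_eq hħ]
  rfl
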